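/- Let $\varGamma$ be a lattice in $\mathbb R^n$, i.e. the integer span of $n$ linearly independent vectors. For a point set $A$ contained in a lattice write ${\rm dens}(A)=\lim_{r\to\infty}|A\cap B_r(0)|/{\rm vol}(B_r(0))$ when the limit exists, where $B_r(0)$ is the open ball of radius $r$ around $0$. Let $S\subset\varGamma$ be a subset whose natural autocorrelation coefficients $\nu_S(z)={\rm dens}\big(S\cap(z+S)\big)$ exist for all $z\in\mathbb R^n$, and let $S'=\varGamma\setminus S$. For $A\in\{S,S'\}$ let $\gamma_A$ be the natural autocorrelation of $A$, i.e. the vague limit, as $r\to\infty$, of $(\omega_r*\widetilde{\omega_r})/{\rm vol}(B_r(0))$, where $\omega_r=\sum_{x\in A\cap B_r(0)}\delta_x$ and $\widetilde{\omega_r}=\sum_{x\in A\cap B_r(0)}\delta_{-x}$, and let the diffraction measure $\hat\gamma_A$ be its Fourier transform as a tempered distribution (with kernel $e^{-2\pi i x\cdot y}$). For a set $A$ write $\delta_A=\sum_{x\in A}\delta_x$, and let $\varGamma^*=\{u\in\mathbb R^n\mid u\cdot v\in\mathbb Z\text{ for all }v\in\varGamma\}$ be the dual lattice. Then ${\rm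 dens}(\varGamma)$, ${\rm dens}(S)$ and ${\rm dens}(S')$ exist, the natural autocorrelations $\gamma_S$ and $\gamma_{S'}$ exist, and the following holds. (1) The autocorrelation coefficients $\nu_{S'}(z)={\rm dens}\big(S'\cap(z+S')\big)$ exist for all $z\in\mathbb R^n$. They are $\nu_{S'}(z)=0$ for all $z\notin\varGamma$, and for $t\in\varGamma$ they satisfy $$\nu_{S'}(t)-{\rm dens}(S')=\nu_S(t)-{\rm dens}(S).$$ (2) If ${\rm dens}(S)={\rm dens}(\varGamma)/2$, then $S$ and $S'$ are homometric, i.e. they have the same natural autocorrelation. (3) The diffraction measures $\hat\gamma_S$ and $\hat\gamma_{S'}$ exist as unique tempered positive measures on $\mathbb R^n$, and $$\hat\gamma_{S'}=\hat\gamma_S+\big({\rm dens}(S')-{\rm dens}(S)\big)\,{\rm dens}(\varGamma)\,\delta_{\varGamma^*}.$$ In particular, $\hat\gamma_{S'}=\hat\gamma_S$ if ${\rm dens}(S')={\rm dens}(S)$. (4) $\hat\gamma_{S'}$ is pure point if and only if $\hat\gamma_S$ is pure point. -/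

import Mathlib

open MeasureTheory Filter Topology
open scoped FourierTransform SchwartzMap

noncomputable section

/-- The natural density of the point set `A` in `ℝⁿ` exists and equals `d`:
`|A ∩ B_r(0)| / vol (B_r(0)) → d` as `r → ∞`. It is used for subsets of a lattice only, so that
all the sets which are counted are finite. -/
def HasDensity {n : ℕ} (A : Set (EuclideanSpace ℝ (Fin n))) (d : ℝ) : Prop :=
  Tendsto (fun r : ℝ => (Set.ncard (A ∩ Metric.ball 0 r) : ℝ) / volume.real
    (Metric.ball (0 : EuclideanSpace ℝ (Fin n)) r)) atTop (𝓝 d)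

/-- The autocorrelation coefficient of `S` at `z` exists and equals `c`, that is,
`dens (S ∩ (z + S)) = c`. -/
def HasAutocorrelationCoefficient {n : ℕ} (S : Set (EuclideanSpace ℝ (Fin n)))
    (z : EuclideanSpace ℝ (Fin n)) (c : ℝ) : Prop :=
  HasDensity (S ∩ (fun x => z + x) '' S) c

/-- The Dirac comb `δ_A = ∑_{x ∈ A} δ_x`. -/
def diracComb {n : ℕ} (A : Set (EuclideanSpace ℝ (Fin n))) :
    Measure (EuclideanSpace ℝ (Fin n)) :=
  Measure.sum fun x : A => Measure.dirac (x : EuclideanSpace ℝ (Fin n))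

/-- The autocorrelation approximant `(ω_r ∗ ω̃_r) / vol (B_r(0))` of `ω = δ_S`, where `ω_r` is the
restriction of `ω` to the open ball `B_r(0)`. As the weights are real, `ω̃_r` is the image of
`ω_r` under `x ↦ -x`. -/
def autocorrelationApproximant {n : ℕ} (S : Set (EuclideanSpace ℝ (Fin n))) (r : ℝ) :
    Measure (EuclideanSpace ℝ (Fin n)) :=
  (volume (Metric.ball (0 : EuclideanSpace ℝ (Fin n)) r))⁻¹ •
    Measure.conv ((diracComb S).restrict (Metric.ball 0 r))
      (((diracComb S).restrict (Metric.ball 0 r)).map fun x => -x)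

/-- `γ` is the natural autocorrelation of `S`: it is a locally finite Borel measure, and the
autocorrelation approximants converge to it vaguely (that is, tested on continuous functions of
compact support) as `r → ∞`. -/
def IsNaturalAutocorrelation {n : ℕ} (S : Set (EuclideanSpace ℝ (Fin n)))
    (γ : Measure (EuclideanSpace ℝ (Fin n))) : Prop :=
  IsLocallyFiniteMeasure γ ∧
    ∀ φ : EuclideanSpace ℝ (Fin n) → ℂ, Continuous φ → HasCompactSupport φ →
      Tendsto (fun r : ℝ => ∫ x, φ x ∂(autocorrelationApproximant S r)) atTop
        (𝓝 (∫ x, φ x ∂γ))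

/-- Two point sets are homometric if they share the same natural autocorrelation. -/
def Homometric {n : ℕ} (S T : Set (EuclideanSpace ℝ (Fin n))) : Prop :=
  ∃ γ : Measure (EuclideanSpace ℝ (Fin n)),
    IsNaturalAutocorrelation S γ ∧ IsNaturalAutocorrelation T γ

/-- `μ` is the Fourier transform of the measure `γ`: both are tempered measures, and `μ` is the
Fourier transform of `γ` in the sense of tempered distributions
(with the kernel `exp (-2πi x·y)`). -/
def IsFourierTransformOfMeasure {n : ℕ} (γ μ : Measure (EuclideanSpace ℝ (Fin n))) : Prop :=
  ∃ (_ : γ.HasTemperateGrowth) (_ : μ.HasTemperateGrowth),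
    𝓕 γ.toTemperedDistribution = μ.toTemperedDistribution

/-- `μ` is the diffraction measure of `S`: the Fourier transform of the natural autocorrelation
of `S`. -/
def IsDiffractionMeasure {n : ℕ} (S : Set (EuclideanSpace ℝ (Fin n)))
    (μ : Measure (EuclideanSpace ℝ (Fin n))) : Prop :=
  ∃ γ : Measure (EuclideanSpace ℝ (Fin n)),
    IsNaturalAutocorrelation S γ ∧ IsFourierTransformOfMeasure γ μ

/-- The dual lattice `{u | u·v ∈ ℤ for all v ∈ Γ}`. -/
def dualLattice {n : ℕ} (Γ : Set (EuclideanSpace ℝ (Fin n))) :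
    Set (EuclideanSpace ℝ (Fin n)) :=
  {u | ∀ v ∈ Γ, ∃ k : ℤ, inner ℝ u v = (k : ℝ)}

/-- A (locally finite) measure is pure point if it is concentrated on a countable set. -/
def IsPurePoint {n : ℕ} (μ : Measure (EuclideanSpace ℝ (Fin n))) : Prop :=
  ∃ C : Set (EuclideanSpace ℝ (Fin n)), C.Countable ∧ μ Cᶜ = 0

end

/-!
Write `d(A)` for the density of a set `A` of lattice points and `ν_A(z)` for its autocorrelation
coefficients.

*Counting.* Comparing balls with unions of translates of a fundamental domain shows that `Γ` has
density `1 / covol Γ` (`hasDensity_lattice`) and that spherical shells of constant width contain a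
negligible number of lattice points (`tendsto_ncard_shell`). Hence densities of subsets of `Γ` are
translation invariant, and inclusion and exclusion for `(Γ \ S) ∩ (t + (Γ \ S))` gives
`ν_{Γ \ S}(t) = d(Γ) - 2 d(S) + ν_S(t)` for `t ∈ Γ`; here `d(S) = ν_S(0)`.

*Autocorrelation.* The approximants integrate a test function `φ` to a finite sum of `φ(t)`, weighted
by the normalized number of pairs of points of `S` in the ball with difference `t`. By the shell
estimate these weights tend to `ν_S(t)`, so that the natural autocorrelation is
`γ_S = ∑_{t ∈ Γ} ν_S(t) δ_t` (`isNaturalAutocorrelation_autocorrelationMeasure`). If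
`d(S) = d(Γ) / 2`, then `ν_S` and `ν_{Γ \ S}` coincide on `Γ`, which is homometry.

*Existence of the diffraction measure.* In the coordinates `⟪y, βᵢ⟫`, where `β` is a basis of `Γ`, the
dual lattice becomes `ℤⁿ`. The coefficients `ν_S` are limits of the Fourier coefficients of positive
densities on the torus, namely of the normalized squared absolute values of exponential sums. Weak
compactness turns them into the Fourier coefficients of a finite measure `σ` on the torus
(`exists_isFiniteMeasure_integral_mFourier_eq_autocorrelation`), so no general form of Bochner's
theorem for tempered distributions is needed. Poisson summation (`hasSum_fourier_latticePoint`) for a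
Schwartz function `f` expresses `∑ₜ 𝓕 f (t) e^{2πi t·y}` as `d(Γ)` times the periodization of `f`;
integrating against `σ` shows that `γ_S` has as its Fourier transform the measure `d(Γ) σ`, lifted
periodically to `ℝⁿ` (`exists_isFourierTransformOfMeasure`). Uniqueness holds because tempered
measures are determined by the integrals of Schwartz functions (`Measure.ext_of_integral_schwartz`).

*Comparison.* On `Γ` the coefficients `ν_{Γ \ S}` and `ν_S` differ by the constant
`c = d(Γ \ S) - d(S)`, so the two diffraction measures differ by `c` times the Fourier transform of the
Dirac comb of `Γ`, which by Poisson summation is `d(Γ)` times the Dirac comb of the dual lattice.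
According to the sign of `c` this is an identity of positive measures when solved for one of the two
diffraction measures. As a Dirac comb of a countable set is pure point, everything else follows.
-/

/-! ### Tempered measures and weighted Dirac combs -/

section Measures

variable {E : Type*} [NormedAddCommGroup E] [MeasurableSpace E]

/-- A tempered measure is finite on balls, because `(1 + ‖x‖) ^ (-N)` is bounded below there. -/
theorem MeasureTheory.Measure.HasTemperateGrowth.isLocallyFiniteMeasure {μ : Measure E}
    (hμ : μ.HasTemperateGrowth) : IsLocallyFiniteMeasure μ := by
  obtain ⟨N, hN⟩ := hμ.exists_integrable
  refine ⟨fun x => ⟨Metric.ball x 1, Metric.ball_mem_nhds x one_pos, ?_⟩⟩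
  have hc : 0 < (2 + ‖x‖) ^ (-(N : ℝ)) := Real.rpow_pos_of_pos (by positivity) _
  refine lt_of_le_of_lt (measure_mono ?_) (hN.measure_norm_ge_lt_top hc)
  intro y hy
  have hy1 : ‖y‖ ≤ 1 + ‖x‖ := by
    have h := norm_sub_norm_le y x
    rw [Metric.mem_ball, dist_eq_norm] at hy
    linarith
  have h1 : (0 : ℝ) < 1 + ‖y‖ := by positivity
  show (2 + ‖x‖) ^ (-(N : ℝ)) ≤ ‖(1 + ‖y‖) ^ (-(N : ℝ))‖
  rw [Real.norm_of_nonneg (Real.rpow_nonneg h1.le _)]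
  exact Real.rpow_le_rpow_of_nonpos h1 (by linarith) (by simp)

variable [BorelSpace E]

/-- The density of a locally finite measure `μ` with respect to a locally finite measure `ρ` is
locally integrable. -/
theorem locallyIntegrable_toReal_rnDeriv {E : Type*} [TopologicalSpace E] [LocallyCompactSpace E]
    [MeasurableSpace E] (μ ρ : Measure E) [IsLocallyFiniteMeasure μ] [SigmaFinite ρ] :
    LocallyIntegrable (fun x => (μ.rnDeriv ρ x).toReal) ρ := by
  rw [locallyIntegrable_iff]
  intro K hK
  exact Measure.integrableOn_toReal_rnDeriv hK.measure_lt_top.ne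

/-- Locally finite measures on a finite-dimensional space which agree on smooth functions of compact
support are equal: their densities with respect to their sum agree almost everywhere. -/
theorem MeasureTheory.Measure.ext_of_integral_contDiff [NormedSpace ℝ E] [FiniteDimensional ℝ E]
    {μ ν : Measure E} [IsLocallyFiniteMeasure μ] [IsLocallyFiniteMeasure ν]
    (h : ∀ g : E → ℝ, ContDiff ℝ (⊤ : ℕ∞) g → HasCompactSupport g →
      ∫ x, g x ∂μ = ∫ x, g x ∂ν) : μ = ν := by
  have : ProperSpace E := FiniteDimensional.proper ℝ E
  obtain ⟨ρ, hρ⟩ : ∃ ρ : Measure E, ρ = μ + ν := ⟨_, rfl⟩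
  have : SigmaFinite ρ := hρ ▸ inferInstance
  have hμl : μ ≪ ρ := hρ ▸ (Measure.le_add_right le_rfl).absolutelyContinuous
  have hνl : ν ≪ ρ := hρ ▸ (Measure.le_add_left le_rfl).absolutelyContinuous
  have hae : ∀ᵐ x ∂ρ, (μ.rnDeriv ρ x).toReal = (ν.rnDeriv ρ x).toReal := by
    refine ae_eq_of_integral_contDiff_smul_eq (locallyIntegrable_toReal_rnDeriv μ ρ)
      (locallyIntegrable_toReal_rnDeriv ν ρ) fun g hg hgc => ?_
    simp only [smul_eq_mul, mul_comm (g _)]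
    simp only [← smul_eq_mul]
    rw [integral_rnDeriv_smul hμl, integral_rnDeriv_smul hνl]
    exact h g hg hgc
  rw [← Measure.withDensity_rnDeriv_eq μ _ hμl, ← Measure.withDensity_rnDeriv_eq ν _ hνl]
  refine withDensity_congr_ae ?_
  filter_upwards [hae, Measure.rnDeriv_lt_top μ ρ, Measure.rnDeriv_lt_top ν ρ] with x hx h1 h2
  exact (ENNReal.toReal_eq_toReal_iff' h1.ne h2.ne).1 hx

/-- Two tempered measures which agree as tempered distributions are equal. -/
theorem MeasureTheory.Measure.ext_of_integral_schwartz [NormedSpace ℝ E] [FiniteDimensional ℝ E]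
    {μ ν : Measure E} (hμ : μ.HasTemperateGrowth) (hν : ν.HasTemperateGrowth)
    (h : ∀ f : 𝓢(E, ℂ), ∫ x, f x ∂μ = ∫ x, f x ∂ν) : μ = ν := by
  have := hμ.isLocallyFiniteMeasure
  have := hν.isLocallyFiniteMeasure
  refine Measure.ext_of_integral_contDiff fun g hg hgc => ?_
  have hgs : ContDiff ℝ (⊤ : ℕ∞) fun x => (g x : ℂ) := Complex.ofRealCLM.contDiff.comp hg
  have hgcs : HasCompactSupport fun x => (g x : ℂ) := hgc.comp_left Complex.ofReal_zero
  have hfg := h (hgcs.toSchwartzMap hgs)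
  change ∫ x, (g x : ℂ) ∂μ = ∫ x, (g x : ℂ) ∂ν at hfg
  rw [integral_complex_ofReal, integral_complex_ofReal] at hfg
  exact_mod_cast hfg

/-- The weighted Dirac comb `∑ᵢ wᵢ δ_{xᵢ}`; negative weights are replaced by `0`. -/
noncomputable def weightedComb {ι : Type*} (w : ι → ℝ) (x : ι → E) : Measure E :=
  Measure.sum fun i => ENNReal.ofReal (w i) • Measure.dirac (x i)

variable {ι : Type*} {F : Type*} [NormedAddCommGroup F]

theorem integrable_weightedComb [Countable ι] {w : ι → ℝ} (hw : ∀ i, 0 ≤ w i) {x : ι → E}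
    {f : E → F} (hf : Summable fun i => w i * ‖f (x i)‖) : Integrable f (weightedComb w x) := by
  rw [weightedComb, integrable_sum_measure_iff]
  refine ⟨fun i => (integrable_dirac (by simp)).smul_measure ENNReal.ofReal_ne_top, ?_⟩
  refine hf.congr fun i => ?_
  rw [integral_smul_measure, integral_dirac, ENNReal.toReal_ofReal (hw i), smul_eq_mul]

theorem integral_weightedComb [NormedSpace ℝ F] [CompleteSpace F] {w : ι → ℝ} (hw : ∀ i, 0 ≤ w i)
    {x : ι → E} {f : E → F} (hf : Integrable f (weightedComb w x)) :
    ∫ y, f y ∂(weightedComb w x) = ∑' i, w i • f (x i) := by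
  rw [weightedComb, integral_sum_measure hf]
  refine tsum_congr fun i => ?_
  rw [integral_smul_measure, integral_dirac, ENNReal.toReal_ofReal (hw i)]

theorem hasTemperateGrowth_weightedComb [Countable ι] {w : ι → ℝ} (hw : ∀ i, 0 ≤ w i) {C : ℝ}
    (hC : ∀ i, w i ≤ C) {x : ι → E} {N : ℕ}
    (hx : Summable fun i => (1 + ‖x i‖) ^ (-(N : ℝ))) :
    (weightedComb w x).HasTemperateGrowth := by
  refine ⟨⟨N, integrable_weightedComb hw ?_⟩⟩
  have hn : ∀ i, 0 ≤ (1 + ‖x i‖) ^ (-(N : ℝ)) := fun i => by positivity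
  refine (hx.mul_left C).of_nonneg_of_le (fun i => by have := hw i; positivity) fun i => ?_
  rw [Real.norm_of_nonneg (hn i)]
  exact mul_le_mul_of_nonneg_right (hC i) (hn i)

end Measures

section EuclideanMeasures

variable {n : ℕ}

local notation "ℰ" d:max => EuclideanSpace ℝ (Fin d)

theorem diracComb_eq_weightedComb (A : Set (ℰ n)) :
    diracComb A = weightedComb (fun _ : A => (1 : ℝ)) fun x : A => (x : ℰ n) := by
  simp [diracComb, weightedComb]

/-- The natural autocorrelation is unique: a locally finite measure is determined by its integrals
of continuous functions of compact support. -/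
theorem IsNaturalAutocorrelation.unique {S : Set (ℰ n)} {γ γ' : Measure (ℰ n)}
    (h : IsNaturalAutocorrelation S γ) (h' : IsNaturalAutocorrelation S γ') : γ = γ' := by
  have := h.1
  have := h'.1
  refine Measure.ext_of_integral_eq_on_compactlySupported fun f => ?_
  have hc : Continuous fun x => (f x : ℂ) := by fun_prop
  have hs : HasCompactSupport fun x => (f x : ℂ) := f.hasCompactSupport.comp_left Complex.ofReal_zero
  have := tendsto_nhds_unique (h.2 _ hc hs) (h'.2 _ hc hs)
  rw [integral_complex_ofReal, integral_complex_ofReal] at this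
  exact_mod_cast this

end EuclideanMeasures

/-! ### Counting lattice points in balls -/

section Density

variable {n : ℕ}

local notation "ℰ" d:max => EuclideanSpace ℝ (Fin d)

theorem volume_real_ball_pos {r : ℝ} (hr : 0 < r) : 0 < volume.real (Metric.ball (0 : ℰ n) r) :=
  ENNReal.toReal_pos (Metric.measure_ball_pos volume _ hr).ne' measure_ball_lt_top.ne

theorem volume_real_ball_eq {r : ℝ} (hr : 0 < r) :
    volume.real (Metric.ball (0 : ℰ n) r) = r ^ n * volume.real (Metric.ball (0 : ℰ n) 1) := by
  rw [Measure.real, Measure.addHaar_ball_of_pos _ _ hr, ENNReal.toReal_mul,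
    ENNReal.toReal_ofReal (by positivity), finrank_euclideanSpace, Fintype.card_fin, Measure.real]

theorem tendsto_volume_ball_add_div (c : ℝ) :
    Tendsto (fun r : ℝ => volume.real (Metric.ball (0 : ℰ n) (r + c)) /
      volume.real (Metric.ball (0 : ℰ n) r)) atTop (𝓝 1) := by
  have h1 : Tendsto (fun r : ℝ => (1 + c / r) ^ n) atTop (𝓝 1) := by
    have : Tendsto (fun r : ℝ => c / r) atTop (𝓝 0) := tendsto_const_nhds.div_atTop tendsto_id
    simpa using (this.const_add 1).pow n
  refine h1.congr' ?_
  filter_upwards [eventually_gt_atTop 0, eventually_gt_atTop (-c)] with r hr hrc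
  have hv := volume_real_ball_pos (n := n) one_pos
  rw [volume_real_ball_eq hr, volume_real_ball_eq (by linarith : 0 < r + c)]
  rw [one_add_div hr.ne', div_pow]
  field_simp

variable (Γ : Submodule ℤ (ℰ n)) [DiscreteTopology Γ]

theorem finite_lattice_inter_ball (x : ℰ n) (r : ℝ) :
    ((Γ : Set (ℰ n)) ∩ Metric.ball x r).Finite := by
  rw [Set.inter_comm]
  have hcl : IsClosed (Γ.toAddSubgroup : Set (ℰ n)) := by
    have : DiscreteTopology Γ.toAddSubgroup := ‹DiscreteTopology Γ›
    exact AddSubgroup.isClosed_of_discrete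
  exact Metric.finite_isBounded_inter_isClosed ⟨‹DiscreteTopology Γ›⟩ Metric.isBounded_ball hcl

variable [IsZLattice ℝ Γ]

/-- The number of lattice points in a ball of radius `r`, times the covolume, lies between the
volumes of two concentric balls whose radii differ from `r` by the size of a fundamental domain:
translate the fundamental domain by the lattice points which are counted. -/
theorem exists_ncard_lattice_inter_ball_bounds :
    ∃ D : ℝ, ∀ r : ℝ,
      volume.real (Metric.ball (0 : ℰ n) (r - D)) ≤
        ((Γ : Set (ℰ n)) ∩ Metric.ball 0 r).ncard * ZLattice.covolume Γ ∧
      ((Γ : Set (ℰ n)) ∩ Metric.ball 0 r).ncard * ZLattice.covolume Γ ≤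
        volume.real (Metric.ball (0 : ℰ n) (r + D)) := by
  classical
  let b := Module.Free.chooseBasis ℤ Γ
  let β := b.ofZLatticeBasis ℝ Γ
  have hβ : Submodule.span ℤ (Set.range β) = Γ := b.ofZLatticeBasis_span ℝ Γ
  have hF := ZLattice.isAddFundamentalDomain b (volume : Measure (ℰ n))
  obtain ⟨D, hD⟩ := (ZSpan.fundamentalDomain_isBounded β).exists_norm_le
  refine ⟨D, fun r => ?_⟩
  have hfin := finite_lattice_inter_ball Γ 0 r
  have hcov : ZLattice.covolume Γ = volume.real (ZSpan.fundamentalDomain β) :=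
    ZLattice.covolume_eq_measure_fundamentalDomain Γ volume hF
  have hFfin : volume (ZSpan.fundamentalDomain β) ≠ ⊤ :=
    (ZSpan.fundamentalDomain_isBounded β).measure_lt_top.ne
  have hFm : MeasurableSet (ZSpan.fundamentalDomain β) := ZSpan.fundamentalDomain_measurableSet β
  have htr : ∀ t : ℰ n, volume ((fun x => t + x) '' ZSpan.fundamentalDomain β) =
      volume (ZSpan.fundamentalDomain β) := fun t => by
    rw [Set.image_add_left, measure_preimage_add]
  have hsum : ∑ t ∈ hfin.toFinset, volume ((fun x => t + x) '' ZSpan.fundamentalDomain β) =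
      ENNReal.ofReal (((Γ : Set (ℰ n)) ∩ Metric.ball 0 r).ncard * ZLattice.covolume Γ) := by
    rw [Finset.sum_congr rfl fun t _ => htr t, Finset.sum_const, nsmul_eq_mul,
      ENNReal.ofReal_mul (by positivity), ENNReal.ofReal_natCast, hcov, ofReal_measureReal hFfin,
      Set.ncard_eq_toFinset_card _ hfin]
  have hnn : 0 ≤ ((Γ : Set (ℰ n)) ∩ Metric.ball 0 r).ncard * ZLattice.covolume Γ :=
    mul_nonneg (by positivity) (ZLattice.covolume_pos Γ volume).le
  constructor
  · rw [Measure.real]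
    refine ENNReal.toReal_le_of_le_ofReal hnn ?_
    rw [← hsum]
    refine (measure_mono ?_).trans (measure_biUnion_finset_le _ _)
    intro x hx
    rw [Metric.mem_ball, dist_zero_right] at hx
    have hfr : ‖ZSpan.fract β x‖ ≤ D := hD _ (ZSpan.fract_mem_fundamentalDomain β x)
    have hfl : (ZSpan.floor β x : ℰ n) ∈ Γ := hβ.le (ZSpan.floor β x).2
    have hadd : (ZSpan.floor β x : ℰ n) + ZSpan.fract β x = x := by rw [ZSpan.fract_apply]; abel
    simp only [Set.Finite.mem_toFinset, Set.mem_iUnion]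
    refine ⟨ZSpan.floor β x, ⟨hfl, ?_⟩, ⟨_, ZSpan.fract_mem_fundamentalDomain β x, hadd⟩⟩
    rw [Metric.mem_ball, dist_zero_right]
    have : (ZSpan.floor β x : ℰ n) = x - ZSpan.fract β x := by exact eq_sub_of_add_eq hadd
    rw [this]
    linarith [norm_sub_le x (ZSpan.fract β x)]
  · rw [Measure.real, ← ENNReal.ofReal_le_iff_le_toReal measure_ball_lt_top.ne, ← hsum,
      ← measure_biUnion_finset]
    · refine measure_mono ?_
      intro x hx
      simp only [Set.Finite.mem_toFinset, Set.mem_iUnion] at hx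
      obtain ⟨t, ⟨_, ht⟩, y, hy, rfl⟩ := hx
      rw [Metric.mem_ball, dist_zero_right] at ht ⊢
      linarith [norm_add_le t y, hD y hy]
    · intro s hs t ht hst
      rw [Function.onFun, Set.disjoint_left]
      rintro _ ⟨x, hx, rfl⟩ ⟨y, hy, hxy⟩
      simp only [Finset.mem_coe, Set.Finite.mem_toFinset] at hs ht
      refine hst ?_
      have h1 : s + x = t + y := hxy.symm
      have hs' : s ∈ Submodule.span ℤ (Set.range β) := hβ.symm ▸ hs.1
      have ht' : t ∈ Submodule.span ℤ (Set.range β) := hβ.symm ▸ ht.1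
      have e1 : ZSpan.fract β (s + x) = x := by
        rw [ZSpan.fract_zSpan_add β x hs', ZSpan.fract_eq_self.2 hx]
      have e2 : ZSpan.fract β (t + y) = y := by
        rw [ZSpan.fract_zSpan_add β y ht', ZSpan.fract_eq_self.2 hy]
      have : x = y := by rw [← e1, h1, e2]
      rw [this] at h1
      exact add_right_cancel h1
    · intro t _
      rw [Set.image_add_left]
      exact hFm.preimage (measurable_const_add _)

theorem hasDensity_lattice : HasDensity (Γ : Set (ℰ n)) (ZLattice.covolume Γ)⁻¹ := by
  obtain ⟨D, hD⟩ := exists_ncard_lattice_inter_ball_bounds Γ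
  have hc := ZLattice.covolume_pos Γ volume
  have h1 := (tendsto_volume_ball_add_div (n := n) (-D)).mul_const (ZLattice.covolume Γ)⁻¹
  have h2 := (tendsto_volume_ball_add_div (n := n) D).mul_const (ZLattice.covolume Γ)⁻¹
  rw [one_mul] at h1 h2
  refine tendsto_of_tendsto_of_tendsto_of_le_of_le' h1 h2 ?_ ?_
  · filter_upwards [eventually_gt_atTop 0] with r hr
    have hv := volume_real_ball_pos (n := n) hr
    have := (hD r).1
    rw [← div_eq_mul_inv, div_div, mul_comm, ← div_div]
    gcongr
    rwa [div_le_iff₀ hc]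
  · filter_upwards [eventually_gt_atTop 0] with r hr
    have hv := volume_real_ball_pos (n := n) hr
    have := (hD r).2
    rw [← div_eq_mul_inv, div_div, mul_comm (volume.real _), ← div_div]
    gcongr
    rwa [le_div_iff₀ hc]

/-- The number of lattice points in a spherical shell of constant width is negligible. -/
theorem tendsto_ncard_shell (c : ℝ) :
    Tendsto (fun r : ℝ => (((Γ : Set (ℰ n)) ∩ (Metric.ball 0 (r + c) \ Metric.ball 0 (r - c))).ncard : ℝ) /
      volume.real (Metric.ball (0 : ℰ n) r)) atTop (𝓝 0) := by
  have hshift : ∀ c : ℝ, Tendsto (fun r : ℝ => (((Γ : Set (ℰ n)) ∩ Metric.ball 0 (r + c)).ncard : ℝ) /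
      volume.real (Metric.ball (0 : ℰ n) r)) atTop (𝓝 (ZLattice.covolume Γ)⁻¹) := by
    intro c
    have h := ((hasDensity_lattice Γ).comp (tendsto_atTop_add_const_right atTop c tendsto_id)).mul
      (tendsto_volume_ball_add_div (n := n) c)
    rw [mul_one] at h
    refine h.congr' ?_
    filter_upwards [eventually_gt_atTop 0, eventually_gt_atTop (-c)] with r hr hrc
    have h1 := volume_real_ball_pos (n := n) hr
    have h2 := volume_real_ball_pos (n := n) (by linarith : 0 < r + c)
    simp only [Function.comp, id]
    field_simp
  have h := (hshift |c|).sub (hshift (-|c|))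
  rw [sub_self] at h
  refine squeeze_zero (fun r => by positivity) (fun r => ?_) h
  rw [← sub_div]
  gcongr
  have hsub : (Γ : Set (ℰ n)) ∩ Metric.ball 0 (r + -|c|) ⊆ (Γ : Set (ℰ n)) ∩ Metric.ball 0 (r + |c|) :=
    Set.inter_subset_inter_right _ (Metric.ball_subset_ball (by linarith [abs_nonneg c]))
  rw [← Nat.cast_sub (Set.ncard_le_ncard hsub (finite_lattice_inter_ball Γ _ _)),
    ← Set.ncard_sdiff hsub (finite_lattice_inter_ball Γ _ _)]
  refine Nat.cast_le.2 (Set.ncard_le_ncard ?_ ((finite_lattice_inter_ball Γ _ _).sdiff))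
  rintro x ⟨hx, h1, h2⟩
  refine ⟨⟨hx, Metric.ball_subset_ball (by linarith [le_abs_self c]) h1⟩, fun h3 => h2 ?_⟩
  exact Metric.ball_subset_ball (by linarith [le_abs_self c]) h3.2

/-- Families of sets of lattice points which differ only in a spherical shell of constant width
have the same asymptotic count. -/
theorem tendsto_ncard_div_of_shell {P Q : ℝ → Set (ℰ n)} (hP : ∀ r, (P r).Finite)
    (hQ : ∀ r, (Q r).Finite) (c : ℝ)
    (hPQ : ∀ r, P r \ Q r ⊆ (Γ : Set (ℰ n)) ∩ (Metric.ball 0 (r + c) \ Metric.ball 0 (r - c)))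
    (hQP : ∀ r, Q r \ P r ⊆ (Γ : Set (ℰ n)) ∩ (Metric.ball 0 (r + c) \ Metric.ball 0 (r - c)))
    {d : ℝ} (h : Tendsto (fun r => ((Q r).ncard : ℝ) / volume.real (Metric.ball (0 : ℰ n) r))
      atTop (𝓝 d)) :
    Tendsto (fun r => ((P r).ncard : ℝ) / volume.real (Metric.ball (0 : ℰ n) r)) atTop (𝓝 d) := by
  have hs := tendsto_ncard_shell Γ c
  have h1 := h.sub hs
  have h2 := h.add hs
  rw [sub_zero] at h1
  rw [add_zero] at h2
  have hfin : ∀ r, ((Γ : Set (ℰ n)) ∩ (Metric.ball 0 (r + c) \ Metric.ball 0 (r - c))).Finite :=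
    fun r => (finite_lattice_inter_ball Γ 0 (r + c)).subset
      (Set.inter_subset_inter_right _ Set.sdiff_subset)
  have key : ∀ {A B C : Set (ℰ n)}, B.Finite → C.Finite → A \ B ⊆ C →
      (A.ncard : ℝ) ≤ B.ncard + C.ncard := by
    intro A B C hB hC hABC
    have e1 := Set.ncard_le_ncard_sdiff_add_ncard A B hB
    have e2 := Set.ncard_le_ncard hABC hC
    exact_mod_cast (by omega : A.ncard ≤ B.ncard + C.ncard)
  refine tendsto_of_tendsto_of_tendsto_of_le_of_le h1 h2 (fun r => ?_) fun r => ?_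
  · rw [← sub_div]
    gcongr
    linarith [key (hP r) (hfin r) (hQP r)]
  · rw [← add_div]
    gcongr
    exact key (hQ r) (hfin r) (hPQ r)

variable {Γ}

/-- Densities of subsets of a lattice are invariant under translations. -/
theorem HasDensity.image_add_left {A : Set (ℰ n)} (hA : A ⊆ Γ) {d : ℝ} (h : HasDensity A d) (t : ℰ n) :
    HasDensity ((fun x => t + x) '' A) d := by
  have hinj : Function.Injective fun x : ℰ n => t + x := add_right_injective t
  have himg : ∀ r : ℝ, (fun x => t + x) '' A ∩ Metric.ball 0 r =
      (fun x => t + x) '' (A ∩ (fun x => t + x) ⁻¹' Metric.ball 0 r) := fun r => by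
    rw [Set.image_inter_preimage]
  have hball : ∀ r, (A ∩ (fun x => t + x) ⁻¹' Metric.ball 0 r).Finite := fun r => by
    refine (finite_lattice_inter_ball Γ 0 (r + ‖t‖)).subset ?_
    rintro x ⟨hx, hxr⟩
    rw [Set.mem_preimage, Metric.mem_ball, dist_zero_right] at hxr
    refine ⟨hA hx, ?_⟩
    rw [Metric.mem_ball, dist_zero_right]
    have := norm_sub_le (t + x) t
    rw [add_sub_cancel_left] at this
    linarith
  have := tendsto_ncard_div_of_shell Γ (P := fun r => A ∩ (fun x => t + x) ⁻¹' Metric.ball 0 r)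
    (Q := fun r => A ∩ Metric.ball 0 r) hball
    (fun r => (finite_lattice_inter_ball Γ 0 r).subset (Set.inter_subset_inter_left _ hA)) ‖t‖
    ?_ ?_ h
  · refine this.congr fun r => ?_
    rw [himg, Set.ncard_image_of_injective _ hinj]
  · rintro r x ⟨⟨hx, hxr⟩, hxn⟩
    rw [Set.mem_preimage, Metric.mem_ball, dist_zero_right] at hxr
    have h1 : ¬ ‖x‖ < r := fun h => hxn ⟨hx, by rwa [Metric.mem_ball, dist_zero_right]⟩
    refine ⟨hA hx, ?_, ?_⟩ <;> rw [Metric.mem_ball, dist_zero_right]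
    · have := norm_sub_le (t + x) t
      rw [add_sub_cancel_left] at this
      linarith
    · linarith [norm_nonneg t]
  · rintro r x ⟨⟨hx, hxr⟩, hxn⟩
    rw [Metric.mem_ball, dist_zero_right] at hxr
    have h1 : ¬ ‖t + x‖ < r := fun h =>
      hxn ⟨hx, by rwa [Set.mem_preimage, Metric.mem_ball, dist_zero_right]⟩
    refine ⟨hA hx, ?_, ?_⟩ <;> rw [Metric.mem_ball, dist_zero_right]
    · linarith [norm_nonneg t]
    · linarith [norm_add_le t x]

omit [DiscreteTopology Γ] [IsZLattice ℝ Γ] in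
theorem HasDensity.nonneg {A : Set (ℰ n)} {d : ℝ} (h : HasDensity A d) : 0 ≤ d :=
  ge_of_tendsto' h fun r => by positivity

theorem HasDensity.le_inv_covolume {A : Set (ℰ n)} (hA : A ⊆ Γ) {d : ℝ} (h : HasDensity A d) :
    d ≤ (ZLattice.covolume Γ)⁻¹ := by
  refine le_of_tendsto_of_tendsto' h (hasDensity_lattice Γ) fun r => ?_
  gcongr
  exact finite_lattice_inter_ball Γ 0 r

theorem HasDensity.lattice_sdiff {A : Set (ℰ n)} (hA : A ⊆ Γ) {d : ℝ} (h : HasDensity A d) :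
    HasDensity ((Γ : Set (ℰ n)) \ A) ((ZLattice.covolume Γ)⁻¹ - d) := by
  refine ((hasDensity_lattice Γ).sub h).congr fun r => ?_
  have hsub : A ∩ Metric.ball 0 r ⊆ (Γ : Set (ℰ n)) ∩ Metric.ball 0 r :=
    Set.inter_subset_inter_left _ hA
  have hfin := (finite_lattice_inter_ball Γ 0 r).subset hsub
  rw [← sub_div, ← Nat.cast_sub (Set.ncard_le_ncard hsub (finite_lattice_inter_ball Γ 0 r)),
    ← Set.ncard_sdiff hsub hfin, Set.inter_sdiff_distrib_right]

omit [DiscreteTopology Γ] [IsZLattice ℝ Γ] in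
theorem inter_image_add_left_eq_empty {A : Set (ℰ n)} (hA : A ⊆ Γ) {z : ℰ n} (hz : z ∉ Γ) :
    A ∩ (fun x => z + x) '' A = ∅ := by
  refine Set.eq_empty_of_forall_notMem ?_
  rintro _ ⟨h1, y, hy, rfl⟩
  exact hz (by simpa using Γ.sub_mem (hA h1) (hA hy))

/-- The autocorrelation coefficients of the complement, by inclusion and exclusion. -/
theorem HasAutocorrelationCoefficient.lattice_sdiff {S : Set (ℰ n)} (hS : S ⊆ Γ) {d : ℝ}
    (hd : HasDensity S d) {t : ℰ n} (ht : t ∈ Γ) {c : ℝ}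
    (h : HasAutocorrelationCoefficient S t c) :
    HasAutocorrelationCoefficient ((Γ : Set (ℰ n)) \ S) t
      ((ZLattice.covolume Γ)⁻¹ - (d + d - c)) := by
  have htS : (fun x => t + x) '' S ⊆ Γ := by
    rintro _ ⟨y, hy, rfl⟩
    exact Γ.add_mem ht (hS hy)
  have hunion : HasDensity (S ∪ (fun x => t + x) '' S) (d + d - c) := by
    refine ((hd.add (hd.image_add_left hS t)).sub h).congr fun r => ?_
    have f1 := (finite_lattice_inter_ball Γ 0 r).subset
      (Set.inter_subset_inter_left (Metric.ball 0 r) hS)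
    have f2 := (finite_lattice_inter_ball Γ 0 r).subset
      (Set.inter_subset_inter_left (Metric.ball 0 r) htS)
    have e := Set.ncard_union_add_ncard_inter _ _ f1 f2
    rw [← Set.union_inter_distrib_right, ← Set.inter_inter_distrib_right] at e
    rw [← add_div, ← sub_div]
    congr 1
    rw [sub_eq_iff_eq_add]
    exact_mod_cast e.symm
  have heq : ((Γ : Set (ℰ n)) \ S) ∩ (fun x => t + x) '' ((Γ : Set (ℰ n)) \ S) =
      (Γ : Set (ℰ n)) \ (S ∪ (fun x => t + x) '' S) := by
    have hΓ : (fun x => t + x) '' (Γ : Set (ℰ n)) = Γ := by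
      ext x
      refine ⟨?_, fun hx => ⟨x - t, Γ.sub_mem hx ht, by simp⟩⟩
      rintro ⟨y, hy, rfl⟩
      exact Γ.add_mem ht hy
    rw [Set.image_sdiff (add_right_injective t), hΓ, Set.sdiff_inter_sdiff]
  rw [HasAutocorrelationCoefficient, heq]
  exact hunion.lattice_sdiff (Set.union_subset hS htS)

/-- The number of pairs of points of `S` in the ball of radius `r` around `0` whose difference
is `t`. -/
noncomputable def differenceCount (S : Set (ℰ n)) (r : ℝ) (t : ℰ n) : ℕ :=
  {x ∈ S ∩ Metric.ball 0 r | x - t ∈ S ∩ Metric.ball 0 r}.ncard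

/-- Autocorrelation coefficients may be computed with both points in the ball. -/
theorem HasAutocorrelationCoefficient.tendsto_differenceCount {S : Set (ℰ n)} (hS : S ⊆ Γ)
    {t : ℰ n} {c : ℝ} (h : HasAutocorrelationCoefficient S t c) :
    Tendsto (fun r => (differenceCount S r t : ℝ) / volume.real (Metric.ball (0 : ℰ n) r))
      atTop (𝓝 c) := by
  refine tendsto_ncard_div_of_shell Γ (Q := fun r => S ∩ (fun x => t + x) '' S ∩ Metric.ball 0 r)
    (fun r => (finite_lattice_inter_ball Γ 0 r).subset fun _ hx => ⟨hS hx.1.1, hx.1.2⟩)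
    (fun r => (finite_lattice_inter_ball Γ 0 r).subset fun _ hx => ⟨hS hx.1.1, hx.2⟩) ‖t‖ ?_ ?_ h
  · rintro r x ⟨⟨⟨hx, hxr⟩, hxt, -⟩, hn⟩
    exact absurd ⟨⟨hx, x - t, hxt, by simp⟩, hxr⟩ hn
  · rintro r _ ⟨⟨⟨hx, y, hy, rfl⟩, hxr⟩, hn⟩
    have hy' : ¬ ‖y‖ < r := fun h => hn ⟨⟨hx, hxr⟩, by simpa using ⟨hy, h⟩⟩
    simp only [Metric.mem_ball, dist_zero_right] at hxr
    refine ⟨hS hx, ?_, ?_⟩ <;> simp only [Metric.mem_ball, dist_zero_right]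
    · linarith [norm_nonneg t]
    · have := norm_sub_le (t + y) t
      rw [add_sub_cancel_left] at this
      linarith

end Density

/-! ### The natural autocorrelation -/

section Autocorrelation

variable {n : ℕ}

local notation "ℰ" d:max => EuclideanSpace ℝ (Fin d)

theorem differenceCount_eq_sum {S : Set (ℰ n)} {r : ℝ} (hfin : (S ∩ Metric.ball 0 r).Finite)
    (t : ℰ n) : (differenceCount S r t : ℂ) =
      ∑ x ∈ hfin.toFinset, ∑ y ∈ hfin.toFinset, if x - y = t then 1 else 0 := by
  classical
  have h1 : ∀ x ∈ hfin.toFinset, (∑ y ∈ hfin.toFinset, if x - y = t then (1 : ℂ) else 0) =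
      if x - t ∈ hfin.toFinset then 1 else 0 := by
    intro x _
    have : ∀ y, (x - y = t) ↔ (x - t = y) := fun y =>
      ⟨fun h => by rw [← h]; abel, fun h => by rw [← h]; abel⟩
    simp only [this, Finset.sum_ite_eq]
  rw [Finset.sum_congr rfl h1, Finset.sum_boole, differenceCount]
  congr 1
  rw [← Set.ncard_coe_finset]
  congr 1
  ext x
  simp

theorem diracComb_restrict_ball {S : Set (ℰ n)} {r : ℝ} (hfin : (S ∩ Metric.ball 0 r).Finite) :
    (diracComb S).restrict (Metric.ball 0 r) = ∑ x ∈ hfin.toFinset, Measure.dirac x := by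
  classical
  ext A hA
  rw [Measure.restrict_apply hA, diracComb, Measure.sum_apply _ (hA.inter measurableSet_ball),
    tsum_subtype S fun x => Measure.dirac x (A ∩ Metric.ball 0 r),
    tsum_eq_sum (s := hfin.toFinset), Measure.coe_finsetSum, Finset.sum_apply]
  · refine Finset.sum_congr rfl fun x hx => ?_
    rw [Set.Finite.mem_toFinset] at hx
    rw [Set.indicator_of_mem hx.1, Measure.dirac_apply' _ hA,
      Measure.dirac_apply' _ (hA.inter measurableSet_ball)]
    by_cases hxA : x ∈ A <;> simp [Set.indicator, hxA, hx.2, -Metric.mem_ball]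
  · intro x hx
    by_cases hxS : x ∈ S
    · have : x ∉ Metric.ball (0 : ℰ n) r := fun h => hx (by simpa using ⟨hxS, by simpa using h⟩)
      rw [Set.indicator_of_mem hxS, Measure.dirac_apply' _ (hA.inter measurableSet_ball)]
      simp [Set.indicator, this, -Metric.mem_ball]
    · rw [Set.indicator_of_notMem hxS]

/-- Integrals against the autocorrelation approximants are finite sums over differences. -/
theorem integral_autocorrelationApproximant {S : Set (ℰ n)} {r : ℝ}
    (hfin : (S ∩ Metric.ball 0 r).Finite) {φ : ℰ n → ℂ}
    (T : Finset (ℰ n)) (hT : ∀ x ∈ S, ∀ y ∈ S, x - y ∉ T → φ (x - y) = 0) :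
    ∫ x, φ x ∂(autocorrelationApproximant S r) =
      ∑ t ∈ T, ((differenceCount S r t : ℝ) / volume.real (Metric.ball (0 : ℰ n) r)) • φ t := by
  classical
  have hfs : ∀ ψ : ℰ n → ℂ,
      ∫ x, ψ x ∂(∑ x ∈ hfin.toFinset, Measure.dirac x) = ∑ x ∈ hfin.toFinset, ψ x := by
    intro ψ
    rw [integral_finsetSum_measure fun i _ => integrable_dirac (by simp)]
    simp
  have hdd : Measure.conv (∑ x ∈ hfin.toFinset, Measure.dirac x)
      ((∑ x ∈ hfin.toFinset, Measure.dirac x).map fun x : ℰ n => -x) =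
      ∑ x ∈ hfin.toFinset, ∑ y ∈ hfin.toFinset, Measure.dirac (x - y) := by
    ext A hA
    rw [Measure.conv, Measure.map_apply measurable_add hA, Measure.prod_apply (measurable_add hA)]
    rw [lintegral_finsetSum_measure]
    simp only [lintegral_dirac, Measure.coe_finsetSum, Finset.sum_apply]
    refine Finset.sum_congr rfl fun x _ => ?_
    have hm : MeasurableSet (Prod.mk x ⁻¹' ((fun p : ℰ n × ℰ n => p.1 + p.2) ⁻¹' A)) :=
      measurable_prodMk_left (measurable_add hA)
    rw [Measure.map_apply measurable_neg hm]
    simp only [Measure.coe_finsetSum, Finset.sum_apply]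
    refine Finset.sum_congr rfl fun y _ => ?_
    rw [Measure.dirac_apply' _ hA, Measure.dirac_apply' _ (measurable_neg hm)]
    simp [Set.indicator, sub_eq_add_neg]
  rw [autocorrelationApproximant, diracComb_restrict_ball hfin, hdd, integral_smul_measure,
    integral_finsetSum_measure, ENNReal.toReal_inv]
  · have hx : ∀ x ∈ hfin.toFinset,
        ∫ z, φ z ∂(∑ y ∈ hfin.toFinset, Measure.dirac (x - y)) =
        ∑ y ∈ hfin.toFinset, ∑ t ∈ T, if x - y = t then φ t else 0 := by
      intro x hx
      rw [integral_finsetSum_measure fun i _ => integrable_dirac (by simp)]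
      refine Finset.sum_congr rfl fun y hy => ?_
      rw [integral_dirac, Finset.sum_ite_eq]
      split_ifs with h
      · rfl
      · rw [Set.Finite.mem_toFinset] at hx hy
        exact hT x hx.1 y hy.1 h
    rw [Finset.sum_congr rfl hx]
    have : ∀ t ∈ T, ((differenceCount S r t : ℝ) / volume.real (Metric.ball (0 : ℰ n) r)) • φ t =
        (volume (Metric.ball (0 : ℰ n) r)).toReal⁻¹ •
          ∑ x ∈ hfin.toFinset, ∑ y ∈ hfin.toFinset, if x - y = t then φ t else 0 := by
      intro t _
      rw [div_eq_inv_mul, mul_smul, Measure.real]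
      congr 1
      rw [Complex.real_smul, Complex.ofReal_natCast, differenceCount_eq_sum hfin, Finset.sum_mul]
      refine Finset.sum_congr rfl fun x _ => ?_
      rw [Finset.sum_mul]
      refine Finset.sum_congr rfl fun y _ => ?_
      rw [ite_mul, one_mul, zero_mul]
    rw [Finset.sum_congr rfl this, ← Finset.smul_sum]
    congr 1
    rw [Finset.sum_comm (s := T)]
    refine Finset.sum_congr rfl fun x _ => ?_
    rw [Finset.sum_comm]
  · intro x _
    rw [integrable_finsetSum_measure]
    exact fun y _ => integrable_dirac (by simp)

variable {Γ : Submodule ℤ (ℰ n)} [DiscreteTopology Γ] [IsZLattice ℝ Γ]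

variable (Γ) in
theorem summable_lattice_one_add_norm :
    Summable fun t : Γ => (1 + ‖(t : ℰ n)‖) ^ (-((n + 1 : ℕ) : ℝ)) := by
  classical
  have hr : Module.finrank ℤ Γ < n + 1 := by
    rw [ZLattice.rank ℝ Γ, finrank_euclideanSpace, Fintype.card_fin]; exact Nat.lt_succ_self n
  have h1 := ZLattice.summable_norm_pow_inv Γ (n + 1) hr
  have h2 : Summable fun t : Γ => if t = 0 then (1 : ℝ) else 0 :=
    summable_of_ne_finset_zero (s := {0}) fun t ht => if_neg (by simpa using ht)
  refine (h1.add h2).of_nonneg_of_le (fun t => by positivity) fun t => ?_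
  rw [Real.rpow_neg (by positivity), Real.rpow_natCast]
  by_cases ht : t = 0
  · simp [ht]
  · rw [if_neg ht, add_zero, inv_pow]
    have : 0 < ‖t‖ := norm_pos_iff.2 ht
    gcongr
    change ‖(t : ℰ n)‖ ≤ _
    linarith

/-- The measure `∑_{t ∈ Γ} ν(t) δ_t`. -/
noncomputable def autocorrelationMeasure (Γ : Submodule ℤ (ℰ n)) (ν : ℰ n → ℝ) :
    Measure (ℰ n) :=
  weightedComb (fun t : Γ => ν t) fun t : Γ => (t : ℰ n)

theorem hasTemperateGrowth_autocorrelationMeasure {ν : ℰ n → ℝ} (h0 : ∀ z, 0 ≤ ν z) {C : ℝ}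
    (hC : ∀ z, ν z ≤ C) : (autocorrelationMeasure Γ ν).HasTemperateGrowth :=
  hasTemperateGrowth_weightedComb (fun _ => h0 _) (fun _ => hC _) (summable_lattice_one_add_norm Γ)

theorem isNaturalAutocorrelation_autocorrelationMeasure {S : Set (ℰ n)} (hS : S ⊆ Γ)
    {ν : ℰ n → ℝ} (hν : ∀ z, HasAutocorrelationCoefficient S z (ν z)) :
    IsNaturalAutocorrelation S (autocorrelationMeasure Γ ν) := by
  classical
  have h0 : ∀ z, 0 ≤ ν z := fun z => (hν z).nonneg
  have hlf : IsLocallyFiniteMeasure (autocorrelationMeasure Γ ν) :=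
    (hasTemperateGrowth_autocorrelationMeasure h0 fun z =>
      HasDensity.le_inv_covolume (fun x hx => hS hx.1) (hν z)).isLocallyFiniteMeasure
  refine ⟨hlf, fun φ hφ hφc => ?_⟩
  obtain ⟨R, hR⟩ := hφc.isCompact.isBounded.exists_norm_le
  have hTfin := finite_lattice_inter_ball Γ 0 (R + 1)
  have hφ0 : ∀ t ∈ Γ, t ∉ hTfin.toFinset → φ t = 0 := by
    intro t ht hn
    by_contra h
    have hlt : ‖t‖ < R + 1 := by linarith [hR t (subset_tsupport φ h)]
    exact hn (by simpa using ⟨ht, hlt⟩)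
  have hint : Integrable φ (autocorrelationMeasure Γ ν) := hφ.integrable_of_hasCompactSupport hφc
  have hlim : ∫ x, φ x ∂(autocorrelationMeasure Γ ν) = ∑ t ∈ hTfin.toFinset, ν t • φ t := by
    rw [autocorrelationMeasure, integral_weightedComb (fun _ => h0 _) hint]
    change ∑' t : (Γ : Set (ℰ n)), ν t • φ t = _
    rw [tsum_subtype (Γ : Set (ℰ n)) fun t => ν t • φ t, tsum_eq_sum (s := hTfin.toFinset)]
    · refine Finset.sum_congr rfl fun t ht => ?_
      rw [Set.Finite.mem_toFinset] at ht
      rw [Set.indicator_of_mem ht.1]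
    · intro t ht
      by_cases h : t ∈ (Γ : Set (ℰ n))
      · rw [Set.indicator_of_mem h, hφ0 t h ht, smul_zero]
      · rw [Set.indicator_of_notMem h]
  rw [hlim]
  have hsum : Tendsto (fun r => ∑ t ∈ hTfin.toFinset,
      ((differenceCount S r t : ℝ) / volume.real (Metric.ball (0 : ℰ n) r)) • φ t) atTop
      (𝓝 (∑ t ∈ hTfin.toFinset, ν t • φ t)) :=
    tendsto_finsetSum _ fun t _ => ((hν t).tendsto_differenceCount hS).smul_const _
  refine hsum.congr fun r => ?_
  rw [integral_autocorrelationApproximant ((finite_lattice_inter_ball Γ 0 r).subset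
    (Set.inter_subset_inter_left _ hS)) hTfin.toFinset]
  exact fun x hx y hy => hφ0 _ (Γ.sub_mem (hS hx) (hS hy))

end Autocorrelation

/-! ### Coordinates on a lattice and on its dual -/

section Coordinates

variable {n : ℕ}

local notation "ℰ" d:max => EuclideanSpace ℝ (Fin d)

/-- The lattice point `∑ kᵢ βᵢ` with the integer coordinates `k` in the basis `β`. -/
noncomputable def latticePoint (β : Module.Basis (Fin n) ℝ (ℰ n)) (k : Fin n → ℤ) : ℰ n :=
  β.equivFun.symm fun i => (k i : ℝ)

theorem latticePoint_eq_sum (β : Module.Basis (Fin n) ℝ (ℰ n)) (k : Fin n → ℤ) :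
    latticePoint β k = ∑ i, (k i : ℝ) • β i := β.equivFun_symm_apply _

theorem latticePoint_add (β : Module.Basis (Fin n) ℝ (ℰ n)) (k m : Fin n → ℤ) :
    latticePoint β (k + m) = latticePoint β k + latticePoint β m := by
  rw [latticePoint, latticePoint, latticePoint, ← map_add]
  congr 1
  ext i
  simp

theorem latticePoint_neg (β : Module.Basis (Fin n) ℝ (ℰ n)) (k : Fin n → ℤ) :
    latticePoint β (-k) = -latticePoint β k := by
  rw [latticePoint, latticePoint, ← map_neg]
  congr 1
  ext i
  simp

theorem latticePoint_injective (β : Module.Basis (Fin n) ℝ (ℰ n)) :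
    Function.Injective (latticePoint β) := by
  intro k m h
  have := β.equivFun.symm.injective h
  ext i
  exact_mod_cast congrFun this i

theorem mem_span_iff_exists_latticePoint (β : Module.Basis (Fin n) ℝ (ℰ n)) (x : ℰ n) :
    x ∈ Submodule.span ℤ (Set.range β) ↔ ∃ k, latticePoint β k = x := by
  rw [β.mem_span_iff_repr_mem ℤ]
  constructor
  · intro h
    choose k hk using h
    refine ⟨k, ?_⟩
    rw [latticePoint, LinearEquiv.symm_apply_eq]
    ext i
    rw [Module.Basis.equivFun_apply, ← hk i]
    simp
  · rintro ⟨k, rfl⟩ i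
    refine ⟨k i, ?_⟩
    rw [← Module.Basis.equivFun_apply, latticePoint, LinearEquiv.apply_symm_apply]
    simp

/-- Integer coordinates on the lattice spanned by `β`. -/
noncomputable def latticeEquiv (β : Module.Basis (Fin n) ℝ (ℰ n)) :
    (Fin n → ℤ) ≃ Submodule.span ℤ (Set.range β) :=
  Equiv.ofBijective
    (fun k => ⟨latticePoint β k, (mem_span_iff_exists_latticePoint β _).2 ⟨k, rfl⟩⟩)
    ⟨fun _ _ h => latticePoint_injective β (congrArg Subtype.val h), fun x => by
      obtain ⟨k, hk⟩ := (mem_span_iff_exists_latticePoint β x).1 x.2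
      exact ⟨k, Subtype.ext hk⟩⟩

theorem summable_one_add_norm_latticePoint (β : Module.Basis (Fin n) ℝ (ℰ n)) :
    Summable fun k => (1 + ‖latticePoint β k‖) ^ (-((n + 1 : ℕ) : ℝ)) :=
  (latticeEquiv β).summable_iff.2 (summable_lattice_one_add_norm (Submodule.span ℤ (Set.range β)))

/-- The linear equivalence `y ↦ (⟪y, βᵢ⟫)ᵢ`, which maps the dual of the lattice spanned by `β`
onto `ℤⁿ`. -/
noncomputable def dualCoord (β : Module.Basis (Fin n) ℝ (ℰ n)) : ℰ n ≃L[ℝ] (Fin n → ℝ) :=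
  (LinearMap.linearEquivOfInjective
    (LinearMap.pi fun i => (innerₗ (ℰ n)).flip (β i)) (by
      rw [← LinearMap.ker_eq_bot, LinearMap.ker_eq_bot']
      intro y hy
      have h : ∀ i, inner ℝ y (β i) = 0 := fun i => congrFun hy i
      have : innerₗ (ℰ n) y = 0 := β.ext fun i => by simpa using h i
      have h2 : inner ℝ y y = 0 := by simpa using LinearMap.congr_fun this y
      exact inner_self_eq_zero.1 h2) (by simp)).toContinuousLinearEquiv

@[simp]
theorem dualCoord_apply (β : Module.Basis (Fin n) ℝ (ℰ n)) (y : ℰ n) (i : Fin n) :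
    dualCoord β y i = inner ℝ y (β i) := rfl

theorem inner_latticePoint (β : Module.Basis (Fin n) ℝ (ℰ n)) (y : ℰ n) (k : Fin n → ℤ) :
    inner ℝ y (latticePoint β k) = ∑ i, k i * dualCoord β y i := by
  rw [latticePoint_eq_sum, inner_sum]
  exact Finset.sum_congr rfl fun i _ => by rw [real_inner_smul_right, dualCoord_apply]

/-- The basis dual to `β`. -/
noncomputable def dualLatticeBasis (β : Module.Basis (Fin n) ℝ (ℰ n)) : Module.Basis (Fin n) ℝ (ℰ n) :=
  Module.Basis.ofEquivFun (dualCoord β).toLinearEquiv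

theorem latticePoint_dualLatticeBasis (β : Module.Basis (Fin n) ℝ (ℰ n)) (k : Fin n → ℤ) :
    latticePoint (dualLatticeBasis β) k = (dualCoord β).symm fun i => (k i : ℝ) := by
  rw [latticePoint, dualLatticeBasis, Module.Basis.equivFun_ofEquivFun]
  rfl

theorem dualLattice_span (β : Module.Basis (Fin n) ℝ (ℰ n)) :
    dualLattice (Submodule.span ℤ (Set.range β) : Set (ℰ n)) =
      Submodule.span ℤ (Set.range (dualLatticeBasis β)) := by
  ext u
  rw [SetLike.mem_coe, mem_span_iff_exists_latticePoint]
  constructor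
  · intro h
    choose k hk using fun i => h (β i) (Submodule.subset_span ⟨i, rfl⟩)
    refine ⟨k, ?_⟩
    rw [latticePoint_dualLatticeBasis, ContinuousLinearEquiv.symm_apply_eq]
    ext i
    exact (hk i).symm
  · rintro ⟨k, rfl⟩ v hv
    obtain ⟨m, rfl⟩ := (mem_span_iff_exists_latticePoint β v).1 hv
    refine ⟨∑ i, m i * k i, ?_⟩
    rw [inner_latticePoint, latticePoint_dualLatticeBasis, ContinuousLinearEquiv.apply_symm_apply]
    push_cast
    rfl

theorem exists_basis_span_eq (Γ : Submodule ℤ (ℰ n)) [DiscreteTopology Γ] [IsZLattice ℝ Γ] :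
    ∃ β : Module.Basis (Fin n) ℝ (ℰ n), Submodule.span ℤ (Set.range β) = Γ := by
  let b := Module.Free.chooseBasis ℤ Γ
  have hcard : Fintype.card (Module.Free.ChooseBasisIndex ℤ Γ) = Fintype.card (Fin n) := by
    rw [← Module.finrank_eq_card_chooseBasisIndex, ZLattice.rank ℝ Γ, finrank_euclideanSpace]
  let b' := b.reindex (Fintype.equivOfCardEq hcard)
  exact ⟨b'.ofZLatticeBasis ℝ Γ, b'.ofZLatticeBasis_span ℝ Γ⟩

/-- In the coordinates `⟪y, βᵢ⟫` the volume is scaled by the covolume of the lattice. -/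
theorem map_dualCoord_volume (β : Module.Basis (Fin n) ℝ (ℰ n)) :
    Measure.map (dualCoord β) volume =
      ENNReal.ofReal (ZLattice.covolume (Submodule.span ℤ (Set.range β)))⁻¹ • volume := by
  classical
  have hcov : ZLattice.covolume (Submodule.span ℤ (Set.range β)) =
      |(Matrix.of fun i j => β i j).det| := by
    rw [ZLattice.covolume_eq_det_mul_measureReal _ volume (β.restrictScalars ℤ)
      (EuclideanSpace.basisFun (Fin n) ℝ).toBasis,
      measureReal_congr (ZSpan.fundamentalDomain_ae_parallelepiped _ _),
      Measure.real, OrthonormalBasis.coe_toBasis, OrthonormalBasis.volume_parallelepiped,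
      ENNReal.toReal_one, mul_one, Module.Basis.det_apply, ← Matrix.det_transpose]
    congr 2
    ext i j
    simp [Module.Basis.toMatrix_apply]
  have hdet : (Matrix.of fun i j => β i j).det ≠ 0 := by
    rw [← abs_ne_zero, ← hcov]
    exact ZLattice.covolume_ne_zero _ _
  have hA : (dualCoord β : ℰ n → Fin n → ℝ) =
      Matrix.toLin' (Matrix.of fun i j => β i j) ∘ WithLp.ofLp := by
    ext y i
    rw [dualCoord_apply, Function.comp_apply, Matrix.toLin'_apply, Matrix.mulVec, dotProduct,
      PiLp.inner_apply]
    simp [mul_comm]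
  have hm : Measurable (Matrix.toLin' (Matrix.of fun i j => β i j)) :=
    (LinearMap.continuous_of_finiteDimensional _).measurable
  rw [hA, ← Measure.map_map hm (PiLp.volume_preserving_ofLp _).measurable,
    (PiLp.volume_preserving_ofLp _).map_eq, Real.map_matrix_volume_pi_eq_smul_volume_pi hdet, hcov,
    abs_inv]

theorem integral_dualCoord (β : Module.Basis (Fin n) ℝ (ℰ n)) (g : (Fin n → ℝ) → ℂ) :
    ∫ x, g x = ZLattice.covolume (Submodule.span ℤ (Set.range β)) • ∫ y, g (dualCoord β y) := by
  have h := map_dualCoord_volume β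
  have hpos := ZLattice.covolume_pos (Submodule.span ℤ (Set.range β)) volume
  have e : ∫ y, g (dualCoord β y) = ∫ x, g x ∂(Measure.map (dualCoord β) volume) :=
    ((dualCoord β).toHomeomorph.toMeasurableEquiv.measurableEmbedding.integral_map g).symm
  rw [e, h, integral_smul_measure, ENNReal.toReal_ofReal (inv_nonneg.2 hpos.le), smul_smul,
    mul_inv_cancel₀ hpos.ne', one_smul]

end Coordinates

/-! ### Periodization and the Poisson summation formula -/

section Poisson

variable {n : ℕ}

local notation "ℰ" d:max => EuclideanSpace ℝ (Fin d)

/-- The canonical map from `ℝⁿ` onto the torus. -/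
def toTorus (x : Fin n → ℝ) : UnitAddTorus (Fin n) := fun i => (x i : UnitAddCircle)

theorem isOpenQuotientMap_toTorus : IsOpenQuotientMap (toTorus (n := n)) :=
  IsOpenQuotientMap.piMap fun _ => QuotientAddGroup.isOpenQuotientMap_mk

theorem toTorus_add_intCast (x : Fin n → ℝ) (k : Fin n → ℤ) :
    toTorus (x + fun i => (k i : ℝ)) = toTorus x := by
  ext i
  simp [toTorus]

theorem toTorus_eq_iff {x x' : Fin n → ℝ} :
    toTorus x = toTorus x' ↔ ∃ k : Fin n → ℤ, x' = x + fun i => (k i : ℝ) := by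
  constructor
  · intro h
    have h' : ∀ i, ∃ k : ℤ, (k : ℝ) = x' i - x i := fun i => by
      have := congrFun h i
      obtain ⟨k, hk⟩ := (QuotientAddGroup.eq_iff_sub_mem.1 this.symm)
      exact ⟨k, by simpa using hk⟩
    choose k hk using h'
    refine ⟨k, ?_⟩
    ext i
    rw [Pi.add_apply, hk i]
    ring
  · rintro ⟨k, rfl⟩
    exact (toTorus_add_intCast x k).symm

theorem mFourier_toTorus (k : Fin n → ℤ) (x : Fin n → ℝ) :
    UnitAddTorus.mFourier k (toTorus x) =
      Complex.exp (2 * Real.pi * Complex.I * (∑ i, k i * x i : ℝ)) := by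
  change ∏ i, fourier (k i) ((x i : ℝ) : UnitAddCircle) = _
  rw [Complex.ofReal_sum, Finset.mul_sum, Complex.exp_sum]
  refine Finset.prod_congr rfl fun i _ => ?_
  rw [fourier_coe_apply]
  congr 1
  push_cast
  ring

/-- Schwartz functions decay like every power of `(1 + ‖x‖)⁻¹`. -/
theorem SchwartzMap.exists_norm_le_one_add_norm_rpow {V F : Type*} [NormedAddCommGroup V]
    [NormedSpace ℝ V] [NormedAddCommGroup F] [NormedSpace ℝ F] (f : 𝓢(V, F)) (N : ℕ) :
    ∃ C : ℝ, 0 ≤ C ∧ ∀ x, ‖f x‖ ≤ C * (1 + ‖x‖) ^ (-(N : ℝ)) := by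
  refine ⟨2 ^ N * ((Finset.Iic (N, 0)).sup fun m => SchwartzMap.seminorm ℝ m.1 m.2) f,
    by positivity, fun x => ?_⟩
  have := SchwartzMap.one_add_le_sup_seminorm_apply (𝕜 := ℝ) (m := (N, 0)) le_rfl le_rfl f x
  rw [norm_iteratedFDeriv_zero] at this
  rwa [Real.rpow_neg (by positivity), Real.rpow_natCast, ← div_eq_mul_inv,
    le_div_iff₀ (by positivity), mul_comm]

theorem one_add_norm_add_rpow_neg_le {V : Type*} [NormedAddCommGroup V] (x y : V) (N : ℕ) :
    (1 + ‖x + y‖) ^ (-(N : ℝ)) ≤ (1 + ‖x‖) ^ N * (1 + ‖y‖) ^ (-(N : ℝ)) := by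
  have h1 : 1 + ‖y‖ ≤ (1 + ‖x‖) * (1 + ‖x + y‖) := by
    have h := norm_sub_le (x + y) x
    rw [add_sub_cancel_left] at h
    nlinarith [norm_nonneg x, norm_nonneg (x + y)]
  rw [Real.rpow_neg (by positivity), Real.rpow_neg (by positivity), Real.rpow_natCast,
    Real.rpow_natCast, ← div_eq_mul_inv, inv_le_comm₀ (by positivity) (by positivity), inv_div,
    div_le_iff₀ (by positivity), ← mul_pow, mul_comm (1 + ‖x + y‖)]
  gcongr

/-- Lattice translates of a Schwartz function are dominated by a summable sequence, uniformly on
bounded sets. -/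
theorem exists_summable_bound_latticePoint (β : Module.Basis (Fin n) ℝ (ℰ n)) (f : 𝓢(ℰ n, ℂ))
    (R : ℝ) : ∃ u : (Fin n → ℤ) → ℝ, Summable u ∧
      ∀ k, ∀ y : ℰ n, ‖y‖ ≤ R → ‖f (y + latticePoint β k)‖ ≤ u k := by
  obtain ⟨C, hC, hf⟩ := f.exists_norm_le_one_add_norm_rpow (n + 1)
  refine ⟨fun k => C * (1 + R) ^ (n + 1) * (1 + ‖latticePoint β k‖) ^ (-((n + 1 : ℕ) : ℝ)),
    (summable_one_add_norm_latticePoint β).mul_left _, fun k y hy => ?_⟩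
  refine (hf _).trans ?_
  dsimp only
  rw [mul_assoc]
  refine mul_le_mul_of_nonneg_left ((one_add_norm_add_rpow_neg_le _ _ _).trans ?_) hC
  gcongr

theorem summable_latticePoint (β : Module.Basis (Fin n) ℝ (ℰ n)) (f : 𝓢(ℰ n, ℂ)) (y : ℰ n) :
    Summable fun k => f (y + latticePoint β k) := by
  obtain ⟨u, hu, h⟩ := exists_summable_bound_latticePoint β f ‖y‖
  exact hu.of_norm_bounded fun k => h k y le_rfl

theorem continuous_tsum_latticePoint (β : Module.Basis (Fin n) ℝ (ℰ n)) (f : 𝓢(ℰ n, ℂ)) :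
    Continuous fun y => ∑' k, f (y + latticePoint β k) := by
  rw [continuous_iff_continuousAt]
  intro y
  obtain ⟨u, hu, h⟩ := exists_summable_bound_latticePoint β f (‖y‖ + 1)
  have hc : ContinuousOn (fun y => ∑' k, f (y + latticePoint β k)) (Metric.ball y 1) := by
    refine continuousOn_tsum (fun k => ?_) hu fun k z hz => h k z ?_
    · exact (f.continuous.comp (continuous_add_const _)).continuousOn
    · rw [Metric.mem_ball, dist_eq_norm] at hz
      linarith [norm_sub_norm_le z y]
  exact hc.continuousAt (Metric.ball_mem_nhds y one_pos)

/-- The periodization `∑_u f (y + u)`, where `u` runs through the dual of the lattice spanned by `β`,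
as a function of the coordinates `⟪y, βᵢ⟫` of `y`. -/
noncomputable def periodizationLift (β : Module.Basis (Fin n) ℝ (ℰ n)) (f : 𝓢(ℰ n, ℂ)) :
    C(Fin n → ℝ, ℂ) :=
  ⟨fun x => ∑' k, f ((dualCoord β).symm x + latticePoint (dualLatticeBasis β) k),
    (continuous_tsum_latticePoint _ f).comp (dualCoord β).symm.continuous⟩

theorem periodizationLift_factorsThrough (β : Module.Basis (Fin n) ℝ (ℰ n)) (f : 𝓢(ℰ n, ℂ)) :
    Function.FactorsThrough (periodizationLift β f) (toTorus (n := n)) := by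
  intro x x' h
  obtain ⟨m, rfl⟩ := toTorus_eq_iff.1 h
  change ∑' k, _ = ∑' k, _
  rw [← (Equiv.addLeft m).tsum_eq]
  refine tsum_congr fun k => ?_
  rw [Equiv.coe_addLeft, latticePoint_add, latticePoint_dualLatticeBasis β m, ← add_assoc,
    ← map_add]

/-- The periodization of a Schwartz function, as a continuous function on the torus. -/
noncomputable def periodization (β : Module.Basis (Fin n) ℝ (ℰ n)) (f : 𝓢(ℰ n, ℂ)) :
    C(UnitAddTorus (Fin n), ℂ) :=
  Topology.IsQuotientMap.lift (f := ⟨toTorus, isOpenQuotientMap_toTorus.continuous⟩)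
    isOpenQuotientMap_toTorus.isQuotientMap (periodizationLift β f)
    (periodizationLift_factorsThrough β f)

theorem periodization_toTorus (β : Module.Basis (Fin n) ℝ (ℰ n)) (f : 𝓢(ℰ n, ℂ))
    (x : Fin n → ℝ) : periodization β f (toTorus x) =
      ∑' k, f ((dualCoord β).symm x + latticePoint (dualLatticeBasis β) k) :=
  DFunLike.congr_fun (Topology.IsQuotientMap.lift_comp
    (f := ⟨toTorus, isOpenQuotientMap_toTorus.continuous⟩)
    isOpenQuotientMap_toTorus.isQuotientMap (periodizationLift β f)
    (periodizationLift_factorsThrough β f)) x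

/-- The integral over `ℝⁿ` is the integral of the periodization over the unit cube. -/
theorem integral_eq_setIntegral_tsum_intCast {h : (Fin n → ℝ) → ℂ} (hh : Integrable h)
    {u : (Fin n → ℤ) → ℝ} (hu : Summable u)
    (hb : ∀ k : Fin n → ℤ, ∀ x ∈ Set.univ.pi fun _ : Fin n => Set.Ioc (0 : ℝ) 1,
      ‖h (x + fun i => (k i : ℝ))‖ ≤ u k) :
    ∫ x, h x = ∫ x in Set.univ.pi fun _ : Fin n => Set.Ioc (0 : ℝ) 1,
      ∑' k : Fin n → ℤ, h (x + fun i => (k i : ℝ)) := by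
  have hae : ZSpan.fundamentalDomain (Pi.basisFun ℝ (Fin n)) =ᵐ[volume]
      Set.univ.pi fun _ : Fin n => Set.Ioc (0 : ℝ) 1 := by
    rw [ZSpan.fundamentalDomain_pi_basisFun]
    exact Measure.univ_pi_Ico_ae_eq_Icc.trans Measure.univ_pi_Ioc_ae_eq_Icc.symm
  let e := ((Pi.basisFun ℝ (Fin n)).restrictScalars ℤ).equivFun.symm
  have he : ∀ k, ((e k : Submodule.span ℤ (Set.range (Pi.basisFun ℝ (Fin n)))) : Fin n → ℝ) =
      fun i => (k i : ℝ) := by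
    intro k
    simp only [e, Module.Basis.equivFun_symm_apply, Submodule.coe_sum, Submodule.coe_smul,
      Module.Basis.restrictScalars_apply]
    ext i
    simp [Finset.sum_apply, Pi.single_apply]
  have : VAddInvariantMeasure (Submodule.span ℤ (Set.range (Pi.basisFun ℝ (Fin n)))) (Fin n → ℝ)
      volume := ⟨fun c s _ => measure_preimage_add volume (c : Fin n → ℝ) s⟩
  rw [(ZSpan.isAddFundamentalDomain (Pi.basisFun ℝ (Fin n)) volume).integral_eq_tsum'' h hh,
    ← e.toEquiv.tsum_eq]
  have hterm : ∀ k : Fin n → ℤ,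
      ∫ x in ZSpan.fundamentalDomain (Pi.basisFun ℝ (Fin n)), h (e.toEquiv k +ᵥ x) =
      ∫ x in Set.univ.pi fun _ : Fin n => Set.Ioc (0 : ℝ) 1, h (x + fun i => (k i : ℝ)) := by
    intro k
    rw [setIntegral_congr_set hae]
    refine integral_congr_ae (Eventually.of_forall fun x => ?_)
    change h ((e k : Fin n → ℝ) + x) = _
    rw [he, add_comm]
  rw [tsum_congr hterm]
  have hmeas : MeasurableSet (Set.univ.pi fun _ : Fin n => Set.Ioc (0 : ℝ) 1) :=
    MeasurableSet.univ_pi fun _ => measurableSet_Ioc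
  have hfinite : volume (Set.univ.pi fun _ : Fin n => Set.Ioc (0 : ℝ) 1) ≠ ⊤ := by
    rw [volume_pi, Measure.pi_pi]
    simp
  refine (hasSum_integral_of_dominated_convergence (fun k _ => u k) (fun k => ?_) (fun k => ?_)
    (Eventually.of_forall fun _ => hu) (integrableOn_const hfinite) ?_).tsum_eq
  · exact ((hh.comp_add_right _).aestronglyMeasurable).restrict
  · exact (ae_restrict_iff' hmeas).2 (Eventually.of_forall fun x hx => hb k x hx)
  · exact (ae_restrict_iff' hmeas).2 (Eventually.of_forall fun x hx =>
      (hu.of_norm_bounded fun k => hb k x hx).hasSum)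

theorem mFourierCoeff_periodization (β : Module.Basis (Fin n) ℝ (ℰ n)) (f : 𝓢(ℰ n, ℂ))
    (m : Fin n → ℤ) : UnitAddTorus.mFourierCoeff (periodization β f) m =
      ZLattice.covolume (Submodule.span ℤ (Set.range β)) • 𝓕 f (latticePoint β m) := by
  obtain ⟨h, hdef⟩ : ∃ h : (Fin n → ℝ) → ℂ, h = fun x =>
    Complex.exp (-(2 * Real.pi * Complex.I * (∑ i, m i * x i : ℝ))) * f ((dualCoord β).symm x) :=
    ⟨_, rfl⟩
  have hexp : ∀ x : Fin n → ℝ,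
      UnitAddTorus.mFourier (-m) (toTorus x) =
        Complex.exp (-(2 * Real.pi * Complex.I * (∑ i, m i * x i : ℝ))) := by
    intro x
    rw [mFourier_toTorus]
    congr 1
    simp
  have hnorm : ∀ x : Fin n → ℝ, ‖h x‖ = ‖f ((dualCoord β).symm x)‖ := by
    intro x
    have : -(2 * Real.pi * Complex.I * (∑ i, m i * x i : ℝ)) =
        ((-(2 * Real.pi * ∑ i, m i * x i) : ℝ) : ℂ) * Complex.I := by push_cast; ring
    rw [hdef, norm_mul, this, Complex.norm_exp_ofReal_mul_I, one_mul]
  have hshift : ∀ (x : Fin n → ℝ) (k : Fin n → ℤ), h (x + fun i => (k i : ℝ)) =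
      UnitAddTorus.mFourier (-m) (toTorus x) *
        f ((dualCoord β).symm x + latticePoint (dualLatticeBasis β) k) := by
    intro x k
    rw [← toTorus_add_intCast x k, hexp, latticePoint_dualLatticeBasis, ← map_add, hdef]
  have hcont : Continuous h := by
    rw [hdef]
    have h1 : Continuous fun x => f ((dualCoord β).symm x) :=
      f.continuous.comp (dualCoord β).symm.continuous
    fun_prop
  have hint : Integrable h := by
    have hf : Integrable fun x => f ((dualCoord β).symm x) := by
      have hpos := ZLattice.covolume_pos (Submodule.span ℤ (Set.range β)) volume
      have h1 : Integrable (fun x => f ((dualCoord β).symm x))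
          (Measure.map (dualCoord β) volume) := by
        refine ((dualCoord β).toHomeomorph.toMeasurableEquiv.measurableEmbedding.integrable_map_iff
          (g := fun x => f ((dualCoord β).symm x))).2 ?_
        refine f.integrable.congr (Eventually.of_forall fun x => ?_)
        exact congrArg f ((dualCoord β).symm_apply_apply x).symm
      rw [map_dualCoord_volume] at h1
      exact (integrable_smul_measure (by simpa using hpos) ENNReal.ofReal_ne_top).1 h1
    exact hf.norm.mono' hcont.aestronglyMeasurable (Eventually.of_forall fun x => (hnorm x).le)
  have hbdd : Bornology.IsBounded ((dualCoord β).symm '' Set.Icc (0 : Fin n → ℝ) 1) :=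
    (isCompact_Icc.image (dualCoord β).symm.continuous).isBounded
  obtain ⟨R, hR⟩ := hbdd.exists_norm_le
  obtain ⟨u, hu, hub⟩ := exists_summable_bound_latticePoint (dualLatticeBasis β) f R
  have hb : ∀ k : Fin n → ℤ, ∀ x ∈ Set.univ.pi fun _ : Fin n => Set.Ioc (0 : ℝ) 1,
      ‖h (x + fun i => (k i : ℝ))‖ ≤ u k := by
    intro k x hx
    rw [hnorm, map_add, ← latticePoint_dualLatticeBasis]
    exact hub k _ (hR _ ⟨x, ⟨fun i => (hx i trivial).1.le, fun i => (hx i trivial).2⟩, rfl⟩)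
  -- integrate the character times the periodization over the unit cube and unfold
  have hmain := integral_eq_setIntegral_tsum_intCast hint hu hb
  rw [UnitAddTorus.mFourierCoeff_eq_integral _ m 0]
  have hbox : {x : Fin n → ℝ | ∀ i, x i ∈ Set.Ioc ((0 : Fin n → ℝ) i) ((0 : Fin n → ℝ) i + 1)} =
      Set.univ.pi fun _ : Fin n => Set.Ioc (0 : ℝ) 1 := by
    ext x
    simp
  rw [hbox]
  have e1 : ∀ x : Fin n → ℝ, ∑' k : Fin n → ℤ, h (x + fun i => (k i : ℝ)) =
      UnitAddTorus.mFourier (-m) (toTorus x) • periodization β f (toTorus x) := by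
    intro x
    rw [periodization_toTorus, smul_eq_mul, ← tsum_mul_left]
    exact tsum_congr (hshift x)
  simp only [e1] at hmain
  refine hmain.symm.trans ?_
  rw [integral_dualCoord β, SchwartzMap.fourier_coe, Real.fourier_eq]
  congr 1
  refine integral_congr_ae (Eventually.of_forall fun y => ?_)
  dsimp only
  rw [hdef, Circle.smul_def, Real.fourierChar_apply, inner_latticePoint, smul_eq_mul]
  dsimp only
  rw [ContinuousLinearEquiv.symm_apply_apply]
  congr 2
  push_cast
  ring

/-- The **Poisson summation formula**: the periodization of `f` is the sum of its Fourier series,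
whose coefficients are the values of `𝓕 f` on the lattice. -/
theorem hasSum_fourier_latticePoint (β : Module.Basis (Fin n) ℝ (ℰ n)) (f : 𝓢(ℰ n, ℂ))
    (τ : UnitAddTorus (Fin n)) :
    HasSum (fun m => 𝓕 f (latticePoint β m) * UnitAddTorus.mFourier m τ)
      ((ZLattice.covolume (Submodule.span ℤ (Set.range β)))⁻¹ • periodization β f τ) := by
  have hs : Summable (UnitAddTorus.mFourierCoeff (periodization β f)) := by
    have := summable_latticePoint β (𝓕 f) 0
    simp only [zero_add] at this
    exact (this.const_smul _).congr fun m => (mFourierCoeff_periodization β f m).symm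
  have h := (UnitAddTorus.hasSum_mFourier_series_apply_of_summable hs τ).const_smul
    (ZLattice.covolume (Submodule.span ℤ (Set.range β)))⁻¹
  refine h.congr_fun fun m => ?_
  rw [mFourierCoeff_periodization, smul_assoc, smul_smul, inv_mul_cancel₀
    (ZLattice.covolume_ne_zero _ _), one_smul, smul_eq_mul]

end Poisson

/-! ### Positive definite sequences as Fourier coefficients of measures on the torus -/

section Herglotz

variable {n : ℕ}

local notation "ℰ" d:max => EuclideanSpace ℝ (Fin d)

/-- If the Fourier coefficients of a sequence of finite measures on the torus converge, then the
limits are the Fourier coefficients of a finite measure: the masses are the zeroth coefficients,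
hence bounded, and sets of measures of bounded mass are weakly compact. -/
theorem exists_isFiniteMeasure_integral_mFourier_eq
    {μ : ℕ → FiniteMeasure (UnitAddTorus (Fin n))} {c : (Fin n → ℤ) → ℂ}
    (h : ∀ k, Tendsto (fun m => ∫ τ, UnitAddTorus.mFourier k τ ∂(μ m)) atTop (𝓝 (c k))) :
    ∃ σ : Measure (UnitAddTorus (Fin n)), IsFiniteMeasure σ ∧
      ∀ k, ∫ τ, UnitAddTorus.mFourier k τ ∂σ = c k := by
  have hmass : ∀ m, ∫ τ, UnitAddTorus.mFourier (0 : Fin n → ℤ) τ ∂(μ m) = ((μ m).mass : ℂ) := by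
    intro m
    simp only [UnitAddTorus.mFourier_zero, ContinuousMap.one_apply, integral_const]
    rw [Measure.real, ← FiniteMeasure.ennreal_mass, ENNReal.coe_toReal, Complex.real_smul, mul_one]
  obtain ⟨C, hC⟩ : ∃ C : NNReal, ∀ m, (μ m).mass ≤ C := by
    have h0 := (h 0).norm
    simp only [hmass] at h0
    obtain ⟨C, hC⟩ := h0.bddAbove_range
    refine ⟨C.toNNReal, fun m => ?_⟩
    have := hC ⟨m, rfl⟩
    dsimp only at this
    rw [Complex.norm_real, Real.norm_of_nonneg (NNReal.coe_nonneg _)] at this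
    exact NNReal.le_toNNReal_of_coe_le this
  have hcomp := isCompact_setOfPred_finiteMeasure_le_of_compactSpace (UnitAddTorus (Fin n)) C
  obtain ⟨σ, -, hσ⟩ := isCompact_iff_ultrafilter_le_nhds'.1 hcomp ((hyperfilter ℕ).map μ)
    (Ultrafilter.mem_map.2 (Filter.mem_of_superset univ_mem fun m _ => hC m))
  refine ⟨σ, inferInstance, fun k => ?_⟩
  have hlim : Tendsto μ (hyperfilter ℕ : Filter ℕ) (𝓝 σ) := hσ
  have h1 : Tendsto (fun m => ∫ τ, UnitAddTorus.mFourier k τ ∂(μ m)) (hyperfilter ℕ)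
      (𝓝 (∫ τ, UnitAddTorus.mFourier k τ ∂σ)) :=
    (FiniteMeasure.tendsto_iff_forall_integral_rclike_tendsto ℂ).1 hlim
      (BoundedContinuousFunction.mkOfCompact (UnitAddTorus.mFourier k))
  exact tendsto_nhds_unique h1 ((h k).mono_left Nat.hyperfilter_le_atTop)

variable (n) in
/-- The normalized Haar measure of the torus, as the image of the volume of the unit cube. -/
noncomputable def torusHaar : Measure (UnitAddTorus (Fin n)) :=
  (volume.restrict (Set.univ.pi fun _ : Fin n => Set.Ioc (0 : ℝ) 1)).map toTorus

instance isFiniteMeasure_torusHaar : IsFiniteMeasure (torusHaar n) := by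
  have : IsFiniteMeasure (volume.restrict (Set.univ.pi fun _ : Fin n => Set.Ioc (0 : ℝ) 1)) := by
    refine isFiniteMeasure_restrict.2 ?_
    rw [volume_pi, Measure.pi_pi]
    simp
  rw [torusHaar]
  infer_instance

theorem integral_mFourier_torusHaar (k : Fin n → ℤ) :
    ∫ τ, UnitAddTorus.mFourier k τ ∂(torusHaar n) = if k = 0 then 1 else 0 := by
  classical
  have h1 : UnitAddTorus.mFourierCoeff (UnitAddTorus.mFourier (0 : Fin n → ℤ)) (-k) =
      if k = 0 then 1 else 0 := by
    rw [← UnitAddTorus.mFourierCoeff_toLp, ← UnitAddTorus.mFourierBasis_repr]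
    change (UnitAddTorus.mFourierBasis.repr (UnitAddTorus.mFourierLp 2 0)) (-k) = _
    rw [← UnitAddTorus.coe_mFourierBasis, HilbertBasis.repr_self, lp.single_apply]
    simp [Pi.single_apply]
  rw [← h1, UnitAddTorus.mFourierCoeff_eq_integral _ _ 0, torusHaar, integral_map]
  · have hbox : {x : Fin n → ℝ | ∀ i, x i ∈ Set.Ioc ((0 : Fin n → ℝ) i) ((0 : Fin n → ℝ) i + 1)} =
        Set.univ.pi fun _ : Fin n => Set.Ioc (0 : ℝ) 1 := by
      ext x
      simp
    rw [hbox]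
    refine integral_congr_ae (Eventually.of_forall fun x => ?_)
    simp only [neg_neg, UnitAddTorus.mFourier_zero, ContinuousMap.one_apply, smul_eq_mul, mul_one]
    rfl
  · exact isOpenQuotientMap_toTorus.continuous.measurable.aemeasurable
  · exact (UnitAddTorus.mFourier k).continuous.aestronglyMeasurable

/-- The Fourier coefficients of the positive measure with density `V |∑_{x ∈ F} e_{κ x}|²` count the
pairs in `F` with a given difference. -/
theorem exists_finiteMeasure_integral_mFourier_eq_sum {ι : Type*} (F : Finset ι)
    (κ : ι → Fin n → ℤ) {V : ℝ} (hV : 0 ≤ V) :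
    ∃ σ : FiniteMeasure (UnitAddTorus (Fin n)), ∀ k,
      ∫ τ, UnitAddTorus.mFourier k τ ∂σ =
        V * ∑ x ∈ F, ∑ y ∈ F, if κ x - κ y = k then 1 else 0 := by
  classical
  let P : C(UnitAddTorus (Fin n), ℂ) := ∑ x ∈ F, UnitAddTorus.mFourier (κ x)
  let D : C(UnitAddTorus (Fin n), ℝ) := ⟨fun τ => V * ‖P τ‖ ^ 2, by fun_prop⟩
  have hD : ∀ τ, 0 ≤ D τ := fun τ => by change 0 ≤ V * ‖P τ‖ ^ 2; positivity
  have hDint : Integrable D (torusHaar n) := by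
    exact D.continuous.integrable_of_hasCompactSupport (HasCompactSupport.of_compactSpace _)
  have hfin : IsFiniteMeasure ((torusHaar n).withDensity fun τ => ENNReal.ofReal (D τ)) :=
    isFiniteMeasure_withDensity_ofReal hDint.2
  refine ⟨⟨(torusHaar n).withDensity fun τ => ENNReal.ofReal (D τ), hfin⟩, fun k => ?_⟩
  rw [FiniteMeasure.toMeasure_mk]
  rw [integral_withDensity_eq_integral_toReal_smul
    D.continuous.measurable.ennreal_ofReal (Eventually.of_forall fun _ => ENNReal.ofReal_lt_top)]
  have e : ∀ τ, (ENNReal.ofReal (D τ)).toReal • UnitAddTorus.mFourier k τ =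
      V * ∑ x ∈ F, ∑ y ∈ F, UnitAddTorus.mFourier (κ x - κ y + k) τ := by
    intro τ
    rw [ENNReal.toReal_ofReal (hD τ)]
    change ((V * ‖P τ‖ ^ 2 : ℝ) : ℝ) • _ = _
    have hP : ((‖P τ‖ ^ 2 : ℝ) : ℂ) =
        ∑ x ∈ F, ∑ y ∈ F, UnitAddTorus.mFourier (κ x - κ y) τ := by
      rw [← Complex.normSq_eq_norm_sq, ← Complex.mul_conj]
      have : P τ = ∑ x ∈ F, UnitAddTorus.mFourier (κ x) τ := by
        simp [P, ContinuousMap.sum_apply]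
      rw [this, map_sum, Finset.sum_mul_sum]
      refine Finset.sum_congr rfl fun x _ => Finset.sum_congr rfl fun y _ => ?_
      rw [← UnitAddTorus.mFourier_neg, ← UnitAddTorus.mFourier_add, sub_eq_add_neg]
    rw [Complex.real_smul, Complex.ofReal_mul, hP, mul_assoc, Finset.sum_mul]
    congr 1
    refine Finset.sum_congr rfl fun x _ => ?_
    rw [Finset.sum_mul]
    exact Finset.sum_congr rfl fun y _ => UnitAddTorus.mFourier_add.symm
  have hi : ∀ m : Fin n → ℤ, Integrable (UnitAddTorus.mFourier m) (torusHaar n) := fun m =>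
    (UnitAddTorus.mFourier m).continuous.integrable_of_hasCompactSupport
      (HasCompactSupport.of_compactSpace _)
  simp only [e]
  rw [integral_const_mul, integral_finsetSum _ fun x _ => integrable_finsetSum _ fun y _ => hi _]
  congr 1
  -- the roles of `x` and `y` are exchanged here
  rw [Finset.sum_comm]
  refine Finset.sum_congr rfl fun x _ => ?_
  rw [integral_finsetSum _ fun y _ => hi _]
  refine Finset.sum_congr rfl fun y _ => ?_
  rw [integral_mFourier_torusHaar]
  refine if_congr ⟨fun h => ?_, fun h => ?_⟩ rfl rfl
  · rw [← sub_eq_zero, ← neg_eq_zero, ← h]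
    abel
  · rw [← h]
    abel

end Herglotz

/-! ### The diffraction measure -/

section Diffraction

variable {n : ℕ}

local notation "ℰ" d:max => EuclideanSpace ℝ (Fin d)

/-- **Herglotz's theorem** for autocorrelation coefficients: they are the Fourier coefficients of a
finite measure on the torus, a weak limit of the normalized squared absolute values of the
exponential sums over the points of `S` in a large ball. -/
theorem exists_isFiniteMeasure_integral_mFourier_eq_autocorrelation
    (β : Module.Basis (Fin n) ℝ (ℰ n)) {S : Set (ℰ n)}
    (hS : S ⊆ Submodule.span ℤ (Set.range β)) {ν : ℰ n → ℝ}
    (hν : ∀ z, HasAutocorrelationCoefficient S z (ν z)) :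
    ∃ σ : Measure (UnitAddTorus (Fin n)), IsFiniteMeasure σ ∧
      ∀ k, ∫ τ, UnitAddTorus.mFourier k τ ∂σ = ν (latticePoint β k) := by
  classical
  let κ : ℰ n → Fin n → ℤ := Function.invFun (latticePoint β)
  have hκ : ∀ x ∈ S, latticePoint β (κ x) = x := fun x hx =>
    Function.invFun_eq ((mem_span_iff_exists_latticePoint β x).1 (hS hx))
  have hfin : ∀ r : ℝ, (S ∩ Metric.ball 0 r).Finite := fun r =>
    (finite_lattice_inter_ball (Submodule.span ℤ (Set.range β)) 0 r).subset
      (Set.inter_subset_inter_left _ hS)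
  choose μ hμ using fun m : ℕ => exists_finiteMeasure_integral_mFourier_eq_sum
    (hfin m).toFinset κ (V := (volume.real (Metric.ball (0 : ℰ n) m))⁻¹) (by positivity)
  refine exists_isFiniteMeasure_integral_mFourier_eq (μ := μ) fun k => ?_
  have h := ((hν (latticePoint β k)).tendsto_differenceCount hS).comp tendsto_natCast_atTop_atTop
  refine ((Complex.continuous_ofReal.tendsto _).comp h).congr fun m => ?_
  rw [hμ, Function.comp_apply, Function.comp_apply, Complex.ofReal_div, Complex.ofReal_natCast,
    differenceCount_eq_sum (hfin m), div_eq_inv_mul, Complex.ofReal_inv]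
  congr 1
  refine Finset.sum_congr rfl fun x hx => Finset.sum_congr rfl fun y hy => ?_
  rw [Set.Finite.mem_toFinset] at hx hy
  refine if_congr ?_ rfl rfl
  rw [← (latticePoint_injective β).eq_iff, sub_eq_add_neg (κ x), latticePoint_add,
    latticePoint_neg, hκ x hx.1, hκ y hy.1, sub_eq_add_neg]

/-- A bounded measurable section of the map `y ↦ (⟪y, βᵢ⟫ mod 1)ᵢ` onto the torus. -/
noncomputable def torusSection (β : Module.Basis (Fin n) ℝ (ℰ n)) (τ : UnitAddTorus (Fin n)) :
    ℰ n :=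
  (dualCoord β).symm fun i => (AddCircle.equivIoc 1 0 (τ i) : ℝ)

theorem measurable_torusSection (β : Module.Basis (Fin n) ℝ (ℰ n)) :
    Measurable (torusSection β) := by
  refine (dualCoord β).symm.continuous.measurable.comp (measurable_pi_lambda _ fun i => ?_)
  exact measurable_subtype_coe.comp
    ((AddCircle.measurableEquivIoc 1 0).measurable.comp (measurable_pi_apply i))

theorem toTorus_dualCoord_torusSection (β : Module.Basis (Fin n) ℝ (ℰ n))
    (τ : UnitAddTorus (Fin n)) : toTorus (dualCoord β (torusSection β τ)) = τ := by
  rw [torusSection, ContinuousLinearEquiv.apply_symm_apply]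
  ext i
  exact (AddCircle.equivIoc 1 0).symm_apply_apply (τ i)

theorem exists_norm_torusSection_le (β : Module.Basis (Fin n) ℝ (ℰ n)) :
    ∃ R, ∀ τ, ‖torusSection β τ‖ ≤ R := by
  obtain ⟨R, hR⟩ := ((isCompact_Icc (a := (0 : Fin n → ℝ)) (b := 1)).image
    (dualCoord β).symm.continuous).isBounded.exists_norm_le
  refine ⟨R, fun τ => hR _ ⟨_, ⟨fun i => ?_, fun i => ?_⟩, rfl⟩⟩
  · exact (AddCircle.equivIoc 1 0 (τ i)).2.1.le
  · simpa using (AddCircle.equivIoc 1 0 (τ i)).2.2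

theorem periodization_eq_tsum_torusSection (β : Module.Basis (Fin n) ℝ (ℰ n)) (f : 𝓢(ℰ n, ℂ))
    (τ : UnitAddTorus (Fin n)) : periodization β f τ =
      ∑' k, f (torusSection β τ + latticePoint (dualLatticeBasis β) k) := by
  conv_lhs => rw [← toTorus_dualCoord_torusSection β τ]
  rw [periodization_toTorus, ContinuousLinearEquiv.symm_apply_apply]

/-- The measure on `ℝⁿ` which is periodic under the dual of the lattice spanned by `β` and induces
the measure `σ` on the torus, times the density of that lattice. -/
noncomputable def periodicLift (β : Module.Basis (Fin n) ℝ (ℰ n))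
    (σ : Measure (UnitAddTorus (Fin n))) : Measure (ℰ n) :=
  Measure.sum fun k : Fin n → ℤ =>
    ENNReal.ofReal (ZLattice.covolume (Submodule.span ℤ (Set.range β)))⁻¹ •
      σ.map fun τ => torusSection β τ + latticePoint (dualLatticeBasis β) k

theorem measurable_torusSection_add (β : Module.Basis (Fin n) ℝ (ℰ n)) (y : ℰ n) :
    Measurable fun τ => torusSection β τ + y := (measurable_torusSection β).add_const y

theorem integrable_periodicLift (β : Module.Basis (Fin n) ℝ (ℰ n))
    (σ : Measure (UnitAddTorus (Fin n))) [IsFiniteMeasure σ] {F : Type*} [NormedAddCommGroup F]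
    {g : ℰ n → F} (hg : Continuous g) {u : (Fin n → ℤ) → ℝ} (hu : Summable u)
    (hb : ∀ k τ, ‖g (torusSection β τ + latticePoint (dualLatticeBasis β) k)‖ ≤ u k) :
    Integrable g (periodicLift β σ) := by
  have hint : ∀ k, Integrable g
      (σ.map fun τ => torusSection β τ + latticePoint (dualLatticeBasis β) k) := by
    intro k
    have hm := measurable_torusSection_add β (latticePoint (dualLatticeBasis β) k)
    have : IsFiniteMeasure
      (σ.map fun τ => torusSection β τ + latticePoint (dualLatticeBasis β) k) := inferInstance
    refine (integrable_const (u k)).mono' hg.aestronglyMeasurable ?_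
    rw [ae_map_iff hm.aemeasurable (measurableSet_le hg.norm.measurable measurable_const)]
    exact Eventually.of_forall fun τ => hb k τ
  rw [periodicLift, integrable_sum_measure_iff]
  refine ⟨fun k => (hint k).smul_measure ENNReal.ofReal_ne_top, ?_⟩
  simp only [integral_smul_measure]
  refine Summable.const_smul _ ?_
  refine (hu.mul_right (σ.real Set.univ)).of_nonneg_of_le
    (fun k => integral_nonneg fun _ => norm_nonneg _) fun k => ?_
  have hm := measurable_torusSection_add β (latticePoint (dualLatticeBasis β) k)
  rw [integral_map hm.aemeasurable hg.norm.aestronglyMeasurable]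
  refine (integral_mono_of_nonneg (Eventually.of_forall fun _ => norm_nonneg _)
    (integrable_const (u k)) (Eventually.of_forall fun τ => hb k τ)).trans ?_
  rw [integral_const, smul_eq_mul, mul_comm]

theorem hasTemperateGrowth_periodicLift (β : Module.Basis (Fin n) ℝ (ℰ n))
    (σ : Measure (UnitAddTorus (Fin n))) [IsFiniteMeasure σ] :
    (periodicLift β σ).HasTemperateGrowth := by
  obtain ⟨R, hR⟩ := exists_norm_torusSection_le β
  refine ⟨⟨n + 1, integrable_periodicLift β σ ?_
    ((summable_one_add_norm_latticePoint (dualLatticeBasis β)).mul_left ((1 + R) ^ (n + 1)))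
    fun k τ => ?_⟩⟩
  · refine Continuous.rpow_const (by fun_prop) fun x => Or.inl ?_
    positivity
  · rw [Real.norm_of_nonneg (by positivity)]
    refine (one_add_norm_add_rpow_neg_le _ _ _).trans ?_
    gcongr
    exact hR τ

theorem integral_periodicLift (β : Module.Basis (Fin n) ℝ (ℰ n))
    (σ : Measure (UnitAddTorus (Fin n))) [IsFiniteMeasure σ] (f : 𝓢(ℰ n, ℂ)) :
    ∫ y, f y ∂(periodicLift β σ) =
      (ZLattice.covolume (Submodule.span ℤ (Set.range β)))⁻¹ • ∫ τ, periodization β f τ ∂σ := by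
  obtain ⟨R, hR⟩ := exists_norm_torusSection_le β
  obtain ⟨u, hu, hub⟩ := exists_summable_bound_latticePoint (dualLatticeBasis β) f R
  have hb : ∀ k τ, ‖f (torusSection β τ + latticePoint (dualLatticeBasis β) k)‖ ≤ u k :=
    fun k τ => hub k _ (hR τ)
  have hint := integrable_periodicLift β σ f.continuous hu hb
  have hpos := ZLattice.covolume_pos (Submodule.span ℤ (Set.range β)) volume
  rw [periodicLift] at hint ⊢
  rw [integral_sum_measure hint]
  simp only [integral_smul_measure, ENNReal.toReal_ofReal (inv_nonneg.2 hpos.le)]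
  rw [tsum_const_smul'']
  congr 1
  simp only [periodization_eq_tsum_torusSection]
  rw [← (hasSum_integral_of_dominated_convergence (fun k _ => u k) (fun k => ?_)
    (fun k => Eventually.of_forall fun τ => hb k τ) (Eventually.of_forall fun _ => hu)
    (integrable_const _)
    (Eventually.of_forall fun τ => (hu.of_norm_bounded fun k => hb k τ).hasSum)).tsum_eq]
  · refine tsum_congr fun k => ?_
    exact integral_map (measurable_torusSection_add β _).aemeasurable
      f.continuous.aestronglyMeasurable
  · exact (f.continuous.measurable.comp (measurable_torusSection_add β _)).aestronglyMeasurable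

theorem integral_autocorrelationMeasure (β : Module.Basis (Fin n) ℝ (ℰ n)) {ν : ℰ n → ℝ}
    (h0 : ∀ z, 0 ≤ ν z) {C : ℝ} (hC : ∀ z, ν z ≤ C) (f : 𝓢(ℰ n, ℂ)) :
    ∫ x, f x ∂(autocorrelationMeasure (Submodule.span ℤ (Set.range β)) ν) =
      ∑' k, ν (latticePoint β k) • f (latticePoint β k) := by
  have := hasTemperateGrowth_autocorrelationMeasure
    (Γ := Submodule.span ℤ (Set.range β)) h0 hC
  have hint : Integrable f (autocorrelationMeasure (Submodule.span ℤ (Set.range β)) ν) :=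
    f.integrable
  rw [autocorrelationMeasure] at hint ⊢
  rw [integral_weightedComb (fun _ => h0 _) hint, ← (latticeEquiv β).tsum_eq]
  rfl

/-- The natural autocorrelation of a subset of a lattice has a measure as its Fourier transform:
with `ν (β k) = ∫ e_k dσ`, the Poisson summation formula gives
`∑ₖ ν (β k) 𝓕 f (β k) = ∫ ∑ₖ 𝓕 f (β k) e_k dσ`, which is the integral of `f` against the periodic
lift of `σ`. -/
theorem exists_isFourierTransformOfMeasure (β : Module.Basis (Fin n) ℝ (ℰ n)) {S : Set (ℰ n)}
    (hS : S ⊆ Submodule.span ℤ (Set.range β)) {ν : ℰ n → ℝ}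
    (hν : ∀ z, HasAutocorrelationCoefficient S z (ν z)) :
    ∃ μ, IsFourierTransformOfMeasure
      (autocorrelationMeasure (Submodule.span ℤ (Set.range β)) ν) μ := by
  obtain ⟨σ, hσ, hσν⟩ := exists_isFiniteMeasure_integral_mFourier_eq_autocorrelation β hS hν
  have h0 : ∀ z, 0 ≤ ν z := fun z => (hν z).nonneg
  have hC : ∀ z, ν z ≤ (ZLattice.covolume (Submodule.span ℤ (Set.range β)))⁻¹ := fun z =>
    HasDensity.le_inv_covolume (fun x hx => hS hx.1) (hν z)
  refine ⟨periodicLift β σ, hasTemperateGrowth_autocorrelationMeasure h0 hC,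
    hasTemperateGrowth_periodicLift β σ, ?_⟩
  ext f
  change ∫ x, 𝓕 f x ∂(autocorrelationMeasure (Submodule.span ℤ (Set.range β)) ν) =
    ∫ x, f x ∂(periodicLift β σ)
  rw [integral_periodicLift,
    integral_autocorrelationMeasure β h0 hC, ← integral_smul]
  have hs : Summable fun k => ‖𝓕 f (latticePoint β k)‖ := by
    have := (summable_latticePoint β (𝓕 f) 0).norm
    simpa only [zero_add] using this
  refine (HasSum.tsum_eq ?_)
  refine (hasSum_integral_of_dominated_convergence (μ := σ)
    (F := fun m τ => 𝓕 f (latticePoint β m) * UnitAddTorus.mFourier m τ)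
    (fun k _ => ‖𝓕 f (latticePoint β k)‖) (fun k => ?_) (fun k => ?_)
    (Eventually.of_forall fun _ => hs) (integrable_const _)
    (Eventually.of_forall fun τ => hasSum_fourier_latticePoint β f τ)).congr_fun fun k => ?_
  · exact (continuous_const.mul (UnitAddTorus.mFourier k).continuous).aestronglyMeasurable
  · refine Eventually.of_forall fun τ => ?_
    rw [norm_mul]
    refine mul_le_of_le_one_right (norm_nonneg _) ?_
    exact ((UnitAddTorus.mFourier k).norm_coe_le_norm τ).trans UnitAddTorus.mFourier_norm.le
  · rw [integral_const_mul, hσν, mul_comm, Complex.real_smul]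

/-- The Fourier transform of the Dirac comb of a lattice is the Dirac comb of the dual lattice, times
the density of the lattice. -/
theorem tsum_fourier_latticePoint (β : Module.Basis (Fin n) ℝ (ℰ n)) (f : 𝓢(ℰ n, ℂ)) :
    ∑' k, 𝓕 f (latticePoint β k) =
      (ZLattice.covolume (Submodule.span ℤ (Set.range β)))⁻¹ •
        ∑' k, f (latticePoint (dualLatticeBasis β) k) := by
  have h := (hasSum_fourier_latticePoint β f (toTorus 0)).tsum_eq
  rw [periodization_toTorus, map_zero] at h
  simp only [zero_add, mFourier_toTorus, Pi.zero_apply, mul_zero, Finset.sum_const_zero,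
    Complex.ofReal_zero, Complex.exp_zero, mul_one] at h
  exact h

theorem diracComb_dualLattice (β : Module.Basis (Fin n) ℝ (ℰ n)) :
    diracComb (dualLattice (Submodule.span ℤ (Set.range β) : Set (ℰ n))) =
      autocorrelationMeasure (Submodule.span ℤ (Set.range (dualLatticeBasis β))) fun _ => 1 := by
  rw [dualLattice_span, diracComb_eq_weightedComb]
  rfl

theorem hasTemperateGrowth_diracComb_dualLattice (β : Module.Basis (Fin n) ℝ (ℰ n)) :
    (diracComb (dualLattice (Submodule.span ℤ (Set.range β) : Set (ℰ n)))).HasTemperateGrowth := by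
  rw [diracComb_dualLattice]
  exact hasTemperateGrowth_autocorrelationMeasure (fun _ => zero_le_one) fun _ => le_rfl

theorem integral_diracComb_dualLattice (β : Module.Basis (Fin n) ℝ (ℰ n)) (f : 𝓢(ℰ n, ℂ)) :
    ∫ x, f x ∂(diracComb (dualLattice (Submodule.span ℤ (Set.range β) : Set (ℰ n)))) =
      ∑' k, f (latticePoint (dualLatticeBasis β) k) := by
  rw [diracComb_dualLattice, integral_autocorrelationMeasure _ (fun _ => zero_le_one)
    fun _ => le_rfl]
  simp only [one_smul]

end Diffraction

/-! ### Comparing the diffraction of complementary sets -/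

section Complement

variable {n : ℕ}

local notation "ℰ" d:max => EuclideanSpace ℝ (Fin d)

theorem MeasureTheory.Measure.HasTemperateGrowth.add_ofReal_smul {μ ρ : Measure (ℰ n)}
    (hμ : μ.HasTemperateGrowth) (hρ : ρ.HasTemperateGrowth) (c : ℝ) :
    (μ + ENNReal.ofReal c • ρ).HasTemperateGrowth := by
  obtain ⟨N, hN⟩ := hμ.exists_integrable
  obtain ⟨M, hM⟩ := hρ.exists_integrable
  have hmono : ∀ (a b : ℕ) (κ : Measure (ℰ n)), a ≤ b →
      Integrable (fun x => (1 + ‖x‖) ^ (-(a : ℝ))) κ →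
      Integrable (fun x => (1 + ‖x‖) ^ (-(b : ℝ))) κ := by
    intro a b κ hab ha
    refine ha.mono' ?_ (Eventually.of_forall fun x => ?_)
    · refine Continuous.aestronglyMeasurable ?_
      refine Continuous.rpow_const (by fun_prop) fun x => Or.inl ?_
      positivity
    · rw [Real.norm_of_nonneg (by positivity)]
      refine Real.rpow_le_rpow_of_exponent_le (by linarith [norm_nonneg x]) ?_
      exact neg_le_neg (by exact_mod_cast hab)
  exact ⟨⟨max N M, (hmono _ _ _ (le_max_left _ _) hN).add_measure
    ((hmono _ _ _ (le_max_right _ _) hM).smul_measure ENNReal.ofReal_ne_top)⟩⟩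

/-- A relation `μ' = μ + c ρ` with `c ≥ 0` between tempered measures holds if it holds for the
tempered distributions. -/
theorem eq_add_ofReal_smul_of_integral_schwartz {μ μ' ρ : Measure (ℰ n)}
    (hμ : μ.HasTemperateGrowth) (hμ' : μ'.HasTemperateGrowth) (hρ : ρ.HasTemperateGrowth) {c : ℝ}
    (hc : 0 ≤ c)
    (h : ∀ f : 𝓢(ℰ n, ℂ), ∫ x, f x ∂μ' = ∫ x, f x ∂μ + (c : ℂ) * ∫ x, f x ∂ρ) :
    μ' = μ + ENNReal.ofReal c • ρ := by
  refine Measure.ext_of_integral_schwartz hμ' (hμ.add_ofReal_smul hρ c) fun f => ?_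
  rw [h, integral_add_measure f.integrable (f.integrable.smul_measure ENNReal.ofReal_ne_top),
    integral_smul_measure, ENNReal.toReal_ofReal hc, Complex.real_smul]

theorem integral_add_ofReal_smul {μ ρ : Measure (ℰ n)} (hμ : μ.HasTemperateGrowth)
    (hρ : ρ.HasTemperateGrowth) {c : ℝ} (hc : 0 ≤ c) {φ : ℰ n → ℂ} (hφ : Continuous φ)
    (hφc : HasCompactSupport φ) :
    ∫ x, φ x ∂(μ + ENNReal.ofReal c • ρ) = ∫ x, φ x ∂μ + (c : ℂ) * ∫ x, φ x ∂ρ := by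
  have := hμ.isLocallyFiniteMeasure
  have := hρ.isLocallyFiniteMeasure
  rw [integral_add_measure (hφ.integrable_of_hasCompactSupport hφc)
    ((hφ.integrable_of_hasCompactSupport hφc).smul_measure ENNReal.ofReal_ne_top),
    integral_smul_measure, ENNReal.toReal_ofReal hc, Complex.real_smul]

theorem isPurePoint_add_smul_diracComb_iff {μ : Measure (ℰ n)} {A : Set (ℰ n)} (hA : A.Countable)
    (a : ENNReal) : IsPurePoint (μ + a • diracComb A) ↔ IsPurePoint μ := by
  constructor
  · rintro ⟨C, hC, h⟩
    exact ⟨C, hC, le_antisymm ((Measure.le_add_right le_rfl _).trans h.le) zero_le⟩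
  · rintro ⟨C, hC, h⟩
    refine ⟨C ∪ A, hC.union hA, ?_⟩
    have h1 : μ (C ∪ A)ᶜ = 0 := measure_mono_null (Set.compl_subset_compl.2 Set.subset_union_left) h
    have h2 : diracComb A (C ∪ A)ᶜ = 0 := by
      have hm : MeasurableSet (C ∪ A)ᶜ := (hC.union hA).measurableSet.compl
      rw [diracComb, Measure.sum_apply _ hm]
      refine ENNReal.tsum_eq_zero.2 fun x => ?_
      rw [Measure.dirac_apply' _ hm]
      simp [Set.indicator]
    rw [Measure.add_apply, Measure.smul_apply, h1, h2, smul_zero, add_zero]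

theorem countable_dualLattice (β : Module.Basis (Fin n) ℝ (ℰ n)) :
    (dualLattice (Submodule.span ℤ (Set.range β) : Set (ℰ n))).Countable := by
  rw [dualLattice_span]
  exact Set.countable_coe_iff.1
    (inferInstance : Countable (Submodule.span ℤ (Set.range (dualLatticeBasis β))))

/-- The diffraction measure of `S` is a tempered measure with explicit integrals of Schwartz
functions. -/
theorem IsDiffractionMeasure.integral_eq {β : Module.Basis (Fin n) ℝ (ℰ n)} {S : Set (ℰ n)}
    (hS : S ⊆ Submodule.span ℤ (Set.range β)) {ν : ℰ n → ℝ}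
    (hν : ∀ z, HasAutocorrelationCoefficient S z (ν z)) {μ : Measure (ℰ n)}
    (hμ : IsDiffractionMeasure S μ) :
    μ.HasTemperateGrowth ∧ ∀ f : 𝓢(ℰ n, ℂ),
      ∫ x, f x ∂μ = ∑' k, ν (latticePoint β k) • 𝓕 f (latticePoint β k) := by
  obtain ⟨γ, hγ, hγt, hμt, hF⟩ := hμ
  obtain rfl := hγ.unique (isNaturalAutocorrelation_autocorrelationMeasure hS hν)
  refine ⟨hμt, fun f => ?_⟩
  rw [← integral_autocorrelationMeasure β (fun z => (hν z).nonneg) fun z =>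
    HasDensity.le_inv_covolume (fun x hx => hS hx.1) (hν z)]
  exact (DFunLike.congr_fun hF f).symm

theorem existsUnique_isDiffractionMeasure {β : Module.Basis (Fin n) ℝ (ℰ n)} {S : Set (ℰ n)}
    (hS : S ⊆ Submodule.span ℤ (Set.range β)) {ν : ℰ n → ℝ}
    (hν : ∀ z, HasAutocorrelationCoefficient S z (ν z)) :
    ∃! μ, IsDiffractionMeasure S μ := by
  obtain ⟨μ, hμ⟩ := exists_isFourierTransformOfMeasure β hS hν
  have hμ' : IsDiffractionMeasure S μ :=
    ⟨_, isNaturalAutocorrelation_autocorrelationMeasure hS hν, hμ⟩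
  refine ⟨μ, hμ', fun ρ hρ => ?_⟩
  obtain ⟨h1, h2⟩ := IsDiffractionMeasure.integral_eq hS hν hμ'
  obtain ⟨h3, h4⟩ := IsDiffractionMeasure.integral_eq hS hν hρ
  exact Measure.ext_of_integral_schwartz h3 h1 fun f => by rw [h4, h2]

/-- If the autocorrelation coefficients of two subsets of a lattice differ by the constant `c` on the
lattice, then their diffraction measures, as tempered distributions, differ by a multiple of the
Dirac comb of the dual lattice. -/
theorem IsDiffractionMeasure.integral_eq_add {β : Module.Basis (Fin n) ℝ (ℰ n)} {S T : Set (ℰ n)}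
    (hS : S ⊆ Submodule.span ℤ (Set.range β)) (hT : T ⊆ Submodule.span ℤ (Set.range β))
    {ν ν' : ℰ n → ℝ} (hν : ∀ z, HasAutocorrelationCoefficient S z (ν z))
    (hν' : ∀ z, HasAutocorrelationCoefficient T z (ν' z)) {c : ℝ}
    (hc : ∀ t ∈ Submodule.span ℤ (Set.range β), ν' t = ν t + c) {μ μ' : Measure (ℰ n)}
    (hμ : IsDiffractionMeasure S μ) (hμ' : IsDiffractionMeasure T μ') (f : 𝓢(ℰ n, ℂ)) :
    ∫ x, f x ∂μ' = ∫ x, f x ∂μ +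
      ((c * (ZLattice.covolume (Submodule.span ℤ (Set.range β)))⁻¹ : ℝ) : ℂ) *
        ∫ x, f x ∂(diracComb (dualLattice (Submodule.span ℤ (Set.range β) : Set (ℰ n)))) := by
  rw [(hμ.integral_eq hS hν).2, (hμ'.integral_eq hT hν').2, integral_diracComb_dualLattice,
    Complex.ofReal_mul, mul_assoc, ← Complex.real_smul (x := (ZLattice.covolume _ _)⁻¹),
    ← tsum_fourier_latticePoint, ← tsum_mul_left]
  have hs : Summable fun k => 𝓕 f (latticePoint β k) := by
    simpa only [zero_add] using summable_latticePoint β (𝓕 f) 0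
  have hsν : Summable fun k => ν (latticePoint β k) • 𝓕 f (latticePoint β k) := by
    refine (hs.norm.mul_left
      (ZLattice.covolume (Submodule.span ℤ (Set.range β)))⁻¹).of_norm_bounded fun k => ?_
    rw [norm_smul, Real.norm_of_nonneg (hν _).nonneg]
    exact mul_le_mul_of_nonneg_right
      (HasDensity.le_inv_covolume (fun x hx => hS hx.1) (hν _)) (norm_nonneg _)
  rw [← hsν.tsum_add (hs.mul_left _)]
  refine tsum_congr fun k => ?_
  rw [hc _ ((mem_span_iff_exists_latticePoint β _).2 ⟨k, rfl⟩), add_smul, ← Complex.real_smul]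

end Complement

/-- The identity of measures in the third part is read, as usual for (complex) Radon measures, as
an identity of linear functionals on the continuous functions of compact support. -/
theorem theorem2 (n : ℕ) (Γ : Submodule ℤ (EuclideanSpace ℝ (Fin n))) [DiscreteTopology Γ]
    [IsZLattice ℝ Γ] (S : Set (EuclideanSpace ℝ (Fin n)))
    (hS : S ⊆ (Γ : Set (EuclideanSpace ℝ (Fin n))))
    (ν : EuclideanSpace ℝ (Fin n) → ℝ)
    (hν : ∀ z : EuclideanSpace ℝ (Fin n), HasAutocorrelationCoefficient S z (ν z)) :
    ∃ dΓ dS dS' : ℝ,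
      HasDensity (Γ : Set (EuclideanSpace ℝ (Fin n))) dΓ ∧
      HasDensity S dS ∧
      HasDensity ((Γ : Set (EuclideanSpace ℝ (Fin n))) \ S) dS' ∧
      -- the autocorrelation coefficients of the complement
      (∃ ν' : EuclideanSpace ℝ (Fin n) → ℝ,
        (∀ z : EuclideanSpace ℝ (Fin n),
          HasAutocorrelationCoefficient ((Γ : Set (EuclideanSpace ℝ (Fin n))) \ S) z (ν' z)) ∧
        (∀ z : EuclideanSpace ℝ (Fin n), z ∉ Γ → ν' z = 0) ∧
        (∀ t : EuclideanSpace ℝ (Fin n), t ∈ Γ → ν' t - dS' = ν t - dS)) ∧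
      -- homometry
      (dS = dΓ / 2 → Homometric S ((Γ : Set (EuclideanSpace ℝ (Fin n))) \ S)) ∧
      -- the diffraction measures exist, are unique, and are related as claimed
      (∃! μ : Measure (EuclideanSpace ℝ (Fin n)), IsDiffractionMeasure S μ) ∧
      (∃! μ' : Measure (EuclideanSpace ℝ (Fin n)),
        IsDiffractionMeasure ((Γ : Set (EuclideanSpace ℝ (Fin n))) \ S) μ') ∧
      (∀ μ μ' : Measure (EuclideanSpace ℝ (Fin n)), IsDiffractionMeasure S μ →
        IsDiffractionMeasure ((Γ : Set (EuclideanSpace ℝ (Fin n))) \ S) μ' →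
        (∀ φ : EuclideanSpace ℝ (Fin n) → ℂ, Continuous φ → HasCompactSupport φ →
          ∫ x, φ x ∂μ' = ∫ x, φ x ∂μ + (((dS' - dS) * dΓ : ℝ) : ℂ) *
            ∫ x, φ x ∂(diracComb (dualLattice (Γ : Set (EuclideanSpace ℝ (Fin n)))))) ∧
        (dS' = dS → μ' = μ) ∧
        -- pure pointedness
        (IsPurePoint μ' ↔ IsPurePoint μ)) := by
  classical
  obtain ⟨β, hΓ⟩ := exists_basis_span_eq Γ
  have hdΓ := hasDensity_lattice Γ
  have hcov := ZLattice.covolume_pos Γ volume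
  -- the density of `S` is the autocorrelation coefficient at `0`
  have hdS : HasDensity S (ν 0) := by
    have := hν 0
    rwa [HasAutocorrelationCoefficient, show (fun x => (0 : EuclideanSpace ℝ (Fin n)) + x) = id from
      funext fun x => zero_add x, Set.image_id, Set.inter_self] at this
  have hdS' := hdS.lattice_sdiff hS
  have hS' : (Γ : Set (EuclideanSpace ℝ (Fin n))) \ S ⊆ Γ := Set.sdiff_subset
  have hzero : HasDensity (∅ : Set (EuclideanSpace ℝ (Fin n))) 0 := by simp [HasDensity]
  obtain ⟨ν', hν'def⟩ : ∃ ν' : EuclideanSpace ℝ (Fin n) → ℝ, ν' = fun z =>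
    if z ∈ Γ then (ZLattice.covolume Γ)⁻¹ - (ν 0 + ν 0 - ν z) else 0 := ⟨_, rfl⟩
  have hν' : ∀ z, HasAutocorrelationCoefficient ((Γ : Set (EuclideanSpace ℝ (Fin n))) \ S) z
      (ν' z) := by
    intro z
    by_cases hz : z ∈ Γ
    · simp only [hν'def, if_pos hz]
      exact (hν z).lattice_sdiff hS hdS hz
    · simp only [hν'def, if_neg hz]
      rw [HasAutocorrelationCoefficient, inter_image_add_left_eq_empty hS' hz]
      exact hzero
  refine ⟨(ZLattice.covolume Γ)⁻¹, ν 0, (ZLattice.covolume Γ)⁻¹ - ν 0, hdΓ, hdS, hdS',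
    ⟨ν', hν', fun z hz => ?_, fun t ht => ?_⟩, fun hhalf => ?_, ?_, ?_, fun μ μ' hμ hμ' => ?_⟩
  · simp only [hν'def, if_neg hz]
  · simp only [hν'def, if_pos ht]
    ring
  · refine ⟨autocorrelationMeasure Γ ν, isNaturalAutocorrelation_autocorrelationMeasure hS hν, ?_⟩
    have heq : autocorrelationMeasure Γ ν = autocorrelationMeasure Γ ν' := by
      rw [autocorrelationMeasure, autocorrelationMeasure]
      congr 1
      ext t
      simp only [hν'def, if_pos t.2]
      linarith
    rw [heq]
    exact isNaturalAutocorrelation_autocorrelationMeasure hS' hν'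
  · subst hΓ
    exact existsUnique_isDiffractionMeasure hS hν
  · subst hΓ
    exact existsUnique_isDiffractionMeasure hS' hν'
  · subst hΓ
    obtain ⟨c, hc⟩ : ∃ c : ℝ,
        c = (ZLattice.covolume (Submodule.span ℤ (Set.range β)))⁻¹ - ν 0 - ν 0 := ⟨_, rfl⟩
    have hcν : ∀ t ∈ Submodule.span ℤ (Set.range β), ν' t = ν t + c := by
      intro t ht
      simp only [hν'def, if_pos ht, hc]
      ring
    have hcν' : ∀ t ∈ Submodule.span ℤ (Set.range β), ν t = ν' t + -c := by
      intro t ht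
      rw [hcν t ht]
      ring
    have hρ := hasTemperateGrowth_diracComb_dualLattice β
    have hcount := countable_dualLattice β
    have hμt := (hμ.integral_eq hS hν).1
    have hμt' := (hμ'.integral_eq hS' hν').1
    rw [← hc]
    -- the relation has nonnegative coefficients when solved for `μ'` or for `μ`
    rcases le_total 0 c with h0 | h0
    · have hnn := mul_nonneg h0 (inv_nonneg.2 hcov.le)
      have heq := eq_add_ofReal_smul_of_integral_schwartz hμt hμt' hρ hnn
        (hμ.integral_eq_add hS hS' hν hν' hcν hμ')
      refine ⟨fun φ hφ hφc => ?_, fun h => ?_, ?_⟩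
      · rw [heq, integral_add_ofReal_smul hμt hρ hnn hφ hφc]
      · have : c = 0 := by linarith
        rw [heq, this]
        simp
      · rw [heq]
        exact isPurePoint_add_smul_diracComb_iff hcount _
    · have hnn := mul_nonneg (neg_nonneg.2 h0) (inv_nonneg.2 hcov.le)
      have heq := eq_add_ofReal_smul_of_integral_schwartz hμt' hμt hρ hnn
        (hμ'.integral_eq_add hS' hS hν' hν hcν' hμ)
      refine ⟨fun φ hφ hφc => ?_, fun h => ?_, ?_⟩
      · rw [heq, integral_add_ofReal_smul hμt' hρ hnn hφ hφc]
        push_cast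
        ring
      · have : c = 0 := by linarith
        rw [heq, this]
        simp
      · rw [heq]
        exact (isPurePoint_add_smul_diracComb_iff hcount _).symm
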